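/- Let $p\in\mathbb N_0$, $\beta=(\beta_0,\dots,\beta_{p+1})\in\mathbb R^{p+2}$ and $N\in\mathbb R$, and put $x_{p+1}=N$. Let $E_{x_i}f(x)=f(x+e_i)$, $\triangle_{x_i}=E_{x_i}-1$, $\nabla_{x_i}=1-E_{x_i}^{-1}$, and let $\mathcal D_x$ be the associative $\mathbb R$-algebra of difference operators $\sum_{\nu\in S}l_\nu(x)E_x^\nu$ with $S\subset\mathbb Z^p$ finite and $l_\nu\in\mathbb R(x_1,\dots,x_p)$, acting on rational functions of $x=(x_1,\dots,x_p)$. For $1\le j\le p$, real parameters $\beta_0,\dots,\beta_{j+1}$ and a quantity $M$ not depending on $x_1,\dots,x_j$ define $$\mathcal L_j(x_1,\dots,x_j;\beta_0,\dots,\beta_{j+1};M)=\sum_{\nu\in\{-1,0,1\}^j\setminus\{0\}}(-1)^{|\nu^-|}A_\nu\,\triangle_x^{\nu^+}\nabla_x^{\nu^-},$$ where $\nu^\pm_i=\max(\pm\nu_i,0)$; for $\nu\in\{0,1\}^j\setminus\{0\}$ with support $i_1<\dots<i_s$, $$A_\nu=(x_{i_1}+\beta_{i_1}-\beta_0)(x_{i_1}+\beta_{i_1})\frac{\prod_{k=2}^s(x_{i_k}+x_{i_{k-1}}+\beta_{i_k})(x_{i_k}+x_{i_{k-1}}+\beta_{i_k}+1)}{\prod_{k=1}^s(2x_{i_k}+\beta_{i_k})(2x_{i_k}+\beta_{i_k}+1)}(x_{i_s}+\beta_{j+1}+M)(M-x_{i_s});$$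 and in general $A_\nu$ is obtained from $A_{\nu^++\nu^-}$ by substituting $x_i\mapsto -x_i-\beta_i$ for every $i$ with $\nu_i=-1$. With $(a)_k=a(a+1)\cdots(a+k-1)$, let $$r_m(a,b,c,d;z)=\sum_{k=0}^m\frac{(-m)_k(m+a+b+1)_k(-z)_k(z+c+d+1)_k}{k!}\,(a+1+k)_{m-k}(b+d+1+k)_{m-k}(c+1+k)_{m-k}$$ be the one-variable Racah polynomial; when $(a+1)_m(b+d+1)_m(c+1)_m\neq0$, it equals $$(a+1)_m(b+d+1)_m(c+1)_m\;{}_4F_3\!\left[\begin{matrix}-m,\ m+a+b+1,\ -z,\ z+c+d+1\\ a+1,\ b+d+1,\ c+1\end{matrix};1\right].$$ For $n\in\mathbb N_0^p$ put $N_1^k=n_1+\dots+n_k$ (with $N_1^0=0$) and let $$R_p(n;x;\beta;N)=\prod_{k=1}^p r_{n_k}\bigl(2N_1^{k-1}+\beta_k-\beta_0-1,\ \beta_{k+1}-\beta_k-1,\ N_1^{k-1}-x_{k+1}-1,\ N_1^{k-1}+\beta_k+x_{k+1};\ -N_1^{k-1}+x_k\bigr)$$ be the multivariable Racah polynomial,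 an element of $\mathbb R[x_1,\dots,x_p]$. Theorem. For $j\in\{1,\dots,p\}$ put $$\mathfrak L^x_j=\mathcal L_j(x_1,\dots,x_j;\beta_0,\dots,\beta_{j+1};x_{j+1}),\qquad \mu_j(n)=-N_1^j\,(N_1^j-1+\beta_{j+1}-\beta_0).$$ Then: 1. $\mathfrak L^x_jR_p(n;x;\beta;N)=\mu_j(n)\,R_p(n;x;\beta;N)$ for every $j\in\{1,\dots,p\}$ and every $n\in\mathbb N_0^p$. 2. The operators $\mathfrak L^x_1,\dots,\mathfrak L^x_p$ commute pairwise, and $\mathcal A_x=\mathbb R[\mathfrak L^x_1,\dots,\mathfrak L^x_p]$ is a commutative subalgebra of $\mathcal D_x$. 3. Consequently every $L\in\mathcal A_x$ acts diagonally on the polynomials $R_p(n;x;\beta;N)$: for every $n\in\mathbb N_0^p$ there is $c\in\mathbb R$ with $L\,R_p(n;x;\beta;N)=c\,R_p(n;x;\beta;N)$. -/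

import Mathlib

namespace Racah

/-! ### Rational functions and difference operators -/

/-- The field `ℝ(x₁, …, x_p)`; the variable `x_{i+1}` is indexed by `i : Fin p`. -/
abbrev RatFun (p : ℕ) : Type := FractionRing (MvPolynomial (Fin p) ℝ)

/-- A polynomial, regarded as a rational function. -/
noncomputable abbrev toRat {p : ℕ} (f : MvPolynomial (Fin p) ℝ) : RatFun p :=
  algebraMap (MvPolynomial (Fin p) ℝ) (RatFun p) f

/-- The substitution `x_i ↦ x_i + c` (other variables fixed), on polynomials. -/
noncomputable def translatePoly {p : ℕ} (i : Fin p) (c : ℝ) :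
    MvPolynomial (Fin p) ℝ →ₐ[ℝ] MvPolynomial (Fin p) ℝ :=
  MvPolynomial.aeval fun k =>
    if k = i then MvPolynomial.X k + MvPolynomial.C c else MvPolynomial.X k

/-- The substitution `x_i ↦ -x_i - b` (other variables fixed), on polynomials. -/
noncomputable def reflectPoly {p : ℕ} (i : Fin p) (b : ℝ) :
    MvPolynomial (Fin p) ℝ →ₐ[ℝ] MvPolynomial (Fin p) ℝ :=
  MvPolynomial.aeval fun k =>
    if k = i then -MvPolynomial.X k - MvPolynomial.C b else MvPolynomial.X k

theorem translatePoly_comp {p : ℕ} (i : Fin p) (c d : ℝ) (h : c + d = 0) :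
    (translatePoly i c).comp (translatePoly i d) = AlgHom.id ℝ _ := by
  apply MvPolynomial.algHom_ext
  intro k
  by_cases hk : k = i
  · simp [translatePoly, hk, MvPolynomial.algebraMap_eq, add_assoc, ← MvPolynomial.C_add, h]
  · simp [translatePoly, hk]

theorem reflectPoly_comp {p : ℕ} (i : Fin p) (b : ℝ) :
    (reflectPoly i b).comp (reflectPoly i b) = AlgHom.id ℝ _ := by
  apply MvPolynomial.algHom_ext
  intro k
  by_cases hk : k = i
  · simp [reflectPoly, hk, MvPolynomial.algebraMap_eq]
  · simp [reflectPoly, hk]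

/-- The shift `E_{x_i}`, `(E_{x_i} f)(x) = f(x + e_i)`, as an automorphism of `ℝ(x₁, …, x_p)`. -/
noncomputable def shift {p : ℕ} (i : Fin p) : RatFun p ≃ₐ[ℝ] RatFun p :=
  IsFractionRing.fieldEquivOfAlgEquiv (FA := ℝ) (FB := RatFun p) (FC := RatFun p)
    (AlgEquiv.ofAlgHom (translatePoly i 1) (translatePoly i (-1))
      (translatePoly_comp i 1 (-1) (by norm_num)) (translatePoly_comp i (-1) 1 (by norm_num)))

/-- The involution `I_i : x_i ↦ -x_i - b`, as an automorphism of `ℝ(x₁, …, x_p)`. -/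
noncomputable def reflect {p : ℕ} (i : Fin p) (b : ℝ) : RatFun p ≃ₐ[ℝ] RatFun p :=
  IsFractionRing.fieldEquivOfAlgEquiv (FA := ℝ) (FB := RatFun p) (FC := RatFun p)
    (AlgEquiv.ofAlgHom (reflectPoly i b) (reflectPoly i b)
      (reflectPoly_comp i b) (reflectPoly_comp i b))

theorem shift_X {p : ℕ} (i k : Fin p) :
    shift i (toRat (MvPolynomial.X k)) =
      toRat (MvPolynomial.X k) + if k = i then 1 else 0 := by
  rw [shift, toRat, IsFractionRing.fieldEquivOfAlgEquiv_algebraMap]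
  by_cases hk : k = i <;> simp [translatePoly, hk]

theorem reflect_X {p : ℕ} (i k : Fin p) (b : ℝ) :
    reflect i b (toRat (MvPolynomial.X k)) =
      if k = i then -toRat (MvPolynomial.X k) - toRat (MvPolynomial.C b)
      else toRat (MvPolynomial.X k) := by
  rw [reflect, toRat, IsFractionRing.fieldEquivOfAlgEquiv_algebraMap]
  by_cases hk : k = i <;> simp [reflectPoly, hk]

/-- Operators on rational functions. -/
abbrev Op (p : ℕ) : Type := Module.End ℝ (RatFun p)

/-- Multiplication by the rational function `f`. -/
noncomputable def mulOp {p : ℕ} (f : RatFun p) : Op p := LinearMap.mulLeft ℝ f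

/-- `E_{x_i}` as an operator. -/
noncomputable def shiftOp {p : ℕ} (i : Fin p) : Op p := (shift i).toLinearMap

/-- `E_{x_i}⁻¹` as an operator. -/
noncomputable def shiftInvOp {p : ℕ} (i : Fin p) : Op p := (shift i).symm.toLinearMap

/-- The forward difference `E_{x_i} - 1`. -/
noncomputable def forwardDiff {p : ℕ} (i : Fin p) : Op p := shiftOp i - 1

/-- The backward difference `1 - E_{x_i}⁻¹`. -/
noncomputable def backwardDiff {p : ℕ} (i : Fin p) : Op p := 1 - shiftInvOp i

/-- The algebra `𝒟_x` of difference operators with rational coefficients: it is generated by the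
multiplications by rational functions, the shifts and their inverses. It is realized by its action
on `ℝ(x₁, …, x_p)`, which is faithful (`coeff_eq_zero` below), so that two difference operators are
equal if and only if their coefficients are. -/
noncomputable def diffAlgebra (p : ℕ) : Subalgebra ℝ (Op p) :=
  Algebra.adjoin ℝ (Set.range mulOp ∪ Set.range shiftOp ∪ Set.range shiftInvOp)

/-- `E_x^ν` for `ν ∈ ℤ^p`. -/
noncomputable def shiftPow {p : ℕ} (ν : Fin p → ℤ) : RatFun p ≃ₐ[ℝ] RatFun p :=
  (List.ofFn fun i => shift i ^ ν i).prod

theorem shift_zpow_X {p : ℕ} (i k : Fin p) (m : ℤ) :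
    (shift i ^ m) (toRat (MvPolynomial.X k)) =
      toRat (MvPolynomial.X k) + if k = i then (m : RatFun p) else 0 := by
  induction m with
  | zero => simp
  | succ m ih =>
    rw [zpow_add_one, AlgEquiv.mul_apply, shift_X, map_add, ih]
    by_cases hk : k = i <;> simp [hk, add_assoc]
  | pred m ih =>
    have h : (shift i)⁻¹ (toRat (MvPolynomial.X k)) =
        toRat (MvPolynomial.X k) - if k = i then 1 else 0 := by
      have e : shift i (toRat (MvPolynomial.X k) - if k = i then 1 else 0) =
          toRat (MvPolynomial.X k) := by
        rw [map_sub, shift_X]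
        by_cases hk : k = i <;> simp [hk]
      have e2 := congrArg (fun z => (shift i)⁻¹ z) e
      simp only [← AlgEquiv.mul_apply, inv_mul_cancel, AlgEquiv.one_apply] at e2
      exact e2.symm
    rw [zpow_sub_one, AlgEquiv.mul_apply, h, map_sub, ih]
    by_cases hk : k = i
    · simp [hk]; ring
    · simp [hk]

theorem shiftPow_X {p : ℕ} (ν : Fin p → ℤ) (k : Fin p) :
    shiftPow ν (toRat (MvPolynomial.X k)) = toRat (MvPolynomial.X k) + (ν k : RatFun p) := by
  have key : ∀ l : List (Fin p),
      (l.map fun i => shift i ^ ν i).prod (toRat (MvPolynomial.X k)) =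
        toRat (MvPolynomial.X k) + (l.map fun i => if k = i then (ν i : RatFun p) else 0).sum := by
    intro l
    induction l with
    | nil => simp
    | cons a l ih =>
      have hs : (shift a ^ ν a) ((l.map fun i => if k = i then (ν i : RatFun p) else 0).sum) =
          (l.map fun i => if k = i then (ν i : RatFun p) else 0).sum := by
        rw [map_list_sum, List.map_map]
        congr 2
        funext i
        by_cases hk : k = i <;> simp [hk]
      rw [List.map_cons, List.prod_cons, AlgEquiv.mul_apply, ih, map_add, shift_zpow_X, hs,
        List.map_cons, List.sum_cons, add_assoc]
  have h := key (List.finRange p)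
  rw [← List.ofFn_eq_map] at h
  rw [shiftPow, h, ← List.ofFn_eq_map, List.sum_ofFn]
  simp

/-- The coefficients of a difference operator `∑ l_ν E_x^ν` are determined by its action on
rational functions. -/
theorem coeff_eq_zero {p : ℕ} (S : Finset (Fin p → ℤ)) (l : (Fin p → ℤ) → RatFun p)
    (h : ∑ ν ∈ S, mulOp (l ν) * (shiftPow ν).toLinearMap = 0) : ∀ ν ∈ S, l ν = 0 := by
  let φ : (Fin p → ℤ) → (RatFun p →* RatFun p) := fun ν => (shiftPow ν : RatFun p →* RatFun p)
  have hφ : Function.Injective φ := by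
    intro ν μ e
    funext k
    have e2 := DFunLike.congr_fun e (toRat (MvPolynomial.X k))
    have e3 : shiftPow ν (toRat (MvPolynomial.X k)) = shiftPow μ (toRat (MvPolynomial.X k)) := e2
    rw [shiftPow_X, shiftPow_X] at e3
    exact_mod_cast add_left_cancel e3
  have hli := (linearIndependent_monoidHom (RatFun p) (RatFun p)).comp φ hφ
  rw [linearIndependent_iff'] at hli
  apply hli S l
  funext f
  have := LinearMap.congr_fun h f
  simpa [mulOp, φ, Finset.sum_apply] using this

/-! ### The operator `𝓛_j` -/

section Operator

variable {p j : ℕ} (hj : j ≤ p) (β : Fin (j + 2) → ℝ) (M : RatFun p)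

/-- The variable `x_{i+1}`, `i : Fin j`, among the first `j` of the variables `x₁, …, x_p`. -/
noncomputable def var (i : Fin j) : RatFun p := toRat (MvPolynomial.X (Fin.castLE hj i))

/-- The parameter `β_i` (`0 ≤ i ≤ j + 1`), as a constant rational function. -/
noncomputable def param (i : Fin (j + 2)) : RatFun p := toRat (MvPolynomial.C (β i))

/-- The parameter `β_{i+1}` belonging to the variable `x_{i+1}`. -/
noncomputable def varParam (i : Fin j) : RatFun p := param β i.succ.castSucc

/-- `A_ν` for `ν ∈ {0,1}^j ∖ {0}`, where `S = {i_1 < ⋯ < i_s}` is the support of `ν` and the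
element `M` takes the place of `N`. In the numerator, the predecessor `i_{k-1}` of `b = i_k`, `k ≥ 2`,
is the largest `a ∈ S` with `a < b`. The value at the empty set is never used. -/
noncomputable def coeffPos (S : Finset (Fin j)) : RatFun p :=
  if hS : S.Nonempty then
    (var hj (S.min' hS) + varParam β (S.min' hS) - param β 0) *
      (var hj (S.min' hS) + varParam β (S.min' hS)) *
    ((∏ b ∈ S, if hb : (S.filter (· < b)).Nonempty then
        let a := (S.filter (· < b)).max' hb
        (var hj b + var hj a + varParam β b) * (var hj b + var hj a + varParam β b + 1)
      else 1) /
      ∏ i ∈ S, (2 * var hj i + varParam β i) * (2 * var hj i + varParam β i + 1)) *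
    ((var hj (S.max' hS) + param β (Fin.last (j + 1)) + M) * (M - var hj (S.max' hS)))
  else 0

/-- `A_ν = I^{ν⁻}(A_{ν⁺ + ν⁻})` for `ν ∈ {-1,0,1}^j ∖ {0}`. -/
noncomputable def coeff (ν : Fin j → SignType) : RatFun p :=
  (List.ofFn fun i : Fin j =>
      if ν i = -1 then reflect (Fin.castLE hj i) (β i.succ.castSucc) else 1).prod
    (coeffPos hj β M (Finset.univ.filter fun i => ν i ≠ 0))

/-- The operator
`𝓛_j(x₁, …, x_j; β₀, …, β_{j+1}; M) = ∑_ν (-1)^{|ν⁻|} A_ν △^{ν⁺} ∇^{ν⁻}`,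
the sum running over `ν ∈ {-1,0,1}^j ∖ {0}`. It acts on rational functions of `x₁, …, x_p`, `p ≥ j`,
and `M` may be a constant or one of the variables `x_{j+1}, …, x_p`. -/
noncomputable def racahOp : Op p :=
  ∑ ν ∈ (Finset.univ : Finset (Fin j → SignType)).filter (· ≠ 0),
    (-1 : ℝ) ^ (Finset.univ.filter fun i => ν i = -1).card •
      (mulOp (coeff hj β M ν) *
        (List.ofFn fun i : Fin j => if ν i = 1 then forwardDiff (Fin.castLE hj i) else 1).prod *
        (List.ofFn fun i : Fin j => if ν i = -1 then backwardDiff (Fin.castLE hj i) else 1).prod)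

end Operator

/-! ### Racah polynomials -/

/-- The shifted factorial `(a)_k = a (a + 1) ⋯ (a + k - 1)`. -/
noncomputable def poch {A : Type*} [CommRing A] (a : A) (k : ℕ) : A :=
  (ascPochhammer A k).eval a

/-- The one-variable Racah polynomial
`(a+1)_n (b+d+1)_n (c+1)_n ₄F₃(-n, n+a+b+1, -x, x+c+d+1; a+1, b+d+1, c+1; 1)`, with the prefactor
multiplied into the terminating series, `(u)_n / (u)_k = (u+k)_{n-k}`. In this form it is a
polynomial in all its arguments; see `racahOne_eq`. -/
noncomputable def racahOne {A : Type*} [CommRing A] [Algebra ℝ A] (n : ℕ) (a b c d x : A) : A :=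
  ∑ k ∈ Finset.range (n + 1),
    ((k.factorial : ℝ)⁻¹) •
      (poch (-(n : A)) k * poch ((n : A) + a + b + 1) k * poch (-x) k * poch (x + c + d + 1) k *
        (poch (a + 1 + k) (n - k) * poch (b + d + 1 + k) (n - k) * poch (c + 1 + k) (n - k)))

theorem poch_split {A : Type*} [CommRing A] (u : A) {n k : ℕ} (h : k ≤ n) :
    poch u k * poch (u + k) (n - k) = poch u n := by
  obtain ⟨m, rfl⟩ := Nat.exists_eq_add_of_le h
  simp [poch, ← ascPochhammer_mul, Polynomial.eval_comp]

/-- The familiar formula, valid as soon as the denominators do not vanish. -/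
theorem racahOne_eq {K : Type*} [Field K] [Algebra ℝ K] (n : ℕ) (a b c d x : K)
    (ha : poch (a + 1) n ≠ 0) (hb : poch (b + d + 1) n ≠ 0) (hc : poch (c + 1) n ≠ 0) :
    racahOne n a b c d x =
      poch (a + 1) n * poch (b + d + 1) n * poch (c + 1) n *
        ∑ k ∈ Finset.range (n + 1),
          (poch (-(n : K)) k * poch ((n : K) + a + b + 1) k * poch (-x) k *
              poch (x + c + d + 1) k) /
            (poch (a + 1) k * poch (b + d + 1) k * poch (c + 1) k * (k.factorial : K)) := by
  rw [racahOne, Finset.mul_sum]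
  refine Finset.sum_congr rfl fun k hk => ?_
  have hkn : k ≤ n := Nat.lt_succ_iff.mp (Finset.mem_range.mp hk)
  have h1 := poch_split (a + 1) hkn
  have h2 := poch_split (b + d + 1) hkn
  have h3 := poch_split (c + 1) hkn
  have ha' : poch (a + 1) k ≠ 0 := fun e => ha (by rw [← h1, e, zero_mul])
  have hb' : poch (b + d + 1) k ≠ 0 := fun e => hb (by rw [← h2, e, zero_mul])
  have hc' : poch (c + 1) k ≠ 0 := fun e => hc (by rw [← h3, e, zero_mul])
  have hf : (k.factorial : K) ≠ 0 := by
    rw [← map_natCast (algebraMap ℝ K)]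
    exact (map_ne_zero _).mpr (Nat.cast_ne_zero.mpr k.factorial_ne_zero)
  rw [← h1, ← h2, ← h3, Algebra.smul_def, map_inv₀, map_natCast]
  field_simp

section Polynomials

variable {p : ℕ} (β : Fin (p + 2) → ℝ) (N : ℝ)

/-- The family `x₁, …, x_p, x_{p+1}` with `x_{p+1} = N`: the index `i : Fin (p + 1)` gives
`x_{i+1}`. -/
noncomputable def extVar (i : Fin (p + 1)) : MvPolynomial (Fin p) ℝ :=
  Fin.snoc (α := fun _ => MvPolynomial (Fin p) ℝ) MvPolynomial.X (MvPolynomial.C N) i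

/-- The multivariable Racah polynomial `R_p(n; x; β; N)`. The factor with index `k : Fin p` is the
factor number `k + 1` in the usual numbering, so that `s = n₁ + ⋯ + n_k`. -/
noncomputable def racahPoly (n : Fin p → ℕ) : MvPolynomial (Fin p) ℝ :=
  ∏ k : Fin p,
    let s : MvPolynomial (Fin p) ℝ := ((∑ i ∈ Finset.Iio k, n i : ℕ) : MvPolynomial (Fin p) ℝ)
    let b : Fin (p + 2) → MvPolynomial (Fin p) ℝ := fun i => MvPolynomial.C (β i)
    let x : MvPolynomial (Fin p) ℝ := extVar N k.castSucc
    let x' : MvPolynomial (Fin p) ℝ := extVar N k.succ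
    racahOne (n k)
      (2 * s + b k.succ.castSucc - b 0 - 1)
      (b k.succ.succ - b k.succ.castSucc - 1)
      (s - x' - 1)
      (s + b k.succ.castSucc + x')
      (-s + x)

/-- The operator `𝔏_{j+1} = 𝓛_{j+1}(x₁, …, x_{j+1}; β₀, …, β_{j+2}; x_{j+2})`, `j : Fin p`,
where `x_{p+1} = N`. -/
noncomputable def racahOpAt (j : Fin p) : Op p :=
  racahOp (p := p) (j := j + 1) j.isLt
    (fun i => β (Fin.castLE (by omega) i)) (toRat (extVar N j.succ))

/-- The eigenvalue
`μ_{j+1}(n) = -(n₁ + ⋯ + n_{j+1}) (n₁ + ⋯ + n_{j+1} - 1 + β_{j+2} - β₀)`, `j : Fin p`. -/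
noncomputable def eigenvalue (j : Fin p) (n : Fin p → ℕ) : ℝ :=
  -(((∑ i ∈ Finset.Iic j, n i : ℕ) : ℝ) *
    (((∑ i ∈ Finset.Iic j, n i : ℕ) : ℝ) - 1 + β j.succ.succ - β 0))

/-- The algebra `𝒜_x = ℝ[𝔏₁, …, 𝔏_p]`. -/
noncomputable def racahAlgebra : Subalgebra ℝ (Op p) :=
  Algebra.adjoin ℝ (Set.range (racahOpAt β N))

end Polynomials

end Racah

/-! The coefficient $A_\nu$ is a product along the chain of active variables, and $M$ meets only the
last of them. Let an arbitrary function $q(u)$ of the last active variable replace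
$(u+\beta_{j+1}+M)(M-u)$. Sorting the $\nu$ by the sign at the last variable then yields a
recursion, `chainOp`: when the last variable is active, the operator in the remaining variables
reappears with a new quadratic $q$ (`sum_chainCoeff_eq_chainOp`).

Below, variables are indexed from $0$, and $b_i$ stands for the parameter of $x_i$. For the
eigenvalue equation, two relations for the product of the first $k$ Racah factors, with $M$ as next
variable, are proved together by induction on $k$ (`IsShiftSystem.chainOp_racahPrefix`): the
eigenvalue equation for $q=(u+b_k+M)(M-u)$, and a contiguous relation for $q=(M+u+b_k)(M+u+b_k+1)$
which lowers $M+1$ to $M$. Nothing more is needed, because every quadratic $q$ is a combination of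
the first function at $M=x_k$ and of the second at $M=x_k$ and $M=-x_k-b_k$ (`chainOp_interpolate`).
Thus `IsShiftSystem.chainOp_succ_mul` strips off the first $k$ factors and leaves a one-variable
operator `diffOp`, which sees the earlier degrees only through their sum $s$. On the basis
`pochBasis` this operator is bidiagonal (`diffOp_pochBasis`), so both relations reduce to two-term
identities between hypergeometric coefficients.

Commutativity follows from having enough common eigenfunctions. If no $\beta_i-\beta_0$ with $i\ge2$
is an integer, the Racah polynomials span the algebra generated by the $x_k(x_k+b_k)$
(`quadAlgebra_le_span_racahTail`). A commutator kills this algebra, and a difference operator that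
does so is zero, by independence of characters (`eq_zero_of_forall_mem`). For arbitrary $\beta_0$,
the operators are affine in $\beta_0$, so the commutator is quadratic in it and vanishes for
infinitely many values, hence always (`commute_racahOpAt`). -/

namespace Racah

/-! ### One-variable Racah polynomials in a Newton-type basis -/

section OneVariable

variable {A : Type*} [CommRing A]

@[simp] theorem poch_zero (u : A) : poch u 0 = 1 := by simp [poch]

theorem poch_succ (u : A) (k : ℕ) : poch u (k + 1) = poch u k * (u + k) := by
  simp [poch, ascPochhammer_succ_eval]

theorem poch_succ_left (u : A) (k : ℕ) : poch u (k + 1) = u * poch (u + 1) k := by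
  simp [poch, ascPochhammer_succ_left, Polynomial.eval_comp]

theorem map_poch {B F : Type*} [CommRing B] [FunLike F A B] [RingHomClass F A B] (φ : F) (u : A)
    (k : ℕ) : φ (poch u k) = poch (φ u) k := by
  induction k with
  | zero => simp
  | succ k ih => rw [poch_succ, poch_succ, map_mul, ih, map_add, map_natCast]

theorem map_racahOne {B : Type*} [CommRing B] [Algebra ℝ A] [Algebra ℝ B] (φ : A →ₐ[ℝ] B)
    (n : ℕ) (a b c d x : A) :
    φ (racahOne n a b c d x) = racahOne n (φ a) (φ b) (φ c) (φ d) (φ x) := by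
  simp [racahOne, map_sum, map_poch]

/-- `∏_{i < l} (s + i - x) (x + s + b + i)`, a polynomial in `x (x + b)`. -/
noncomputable def pochBasis (b s : A) (l : ℕ) (x : A) : A := poch (s - x) l * poch (x + s + b) l

theorem pochBasis_zero (b s x : A) : pochBasis b s 0 x = 1 := by simp [pochBasis]

theorem pochBasis_succ (b s x : A) (l : ℕ) :
    pochBasis b s (l + 1) x = pochBasis b s l x * ((s - x + l) * (x + s + b + l)) := by
  simp only [pochBasis, poch_succ]; ring

/-- Under $x\mapsto x+1$ both rising factorials slide by one place. The prefactor supplies the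
missing left end of the second one, so that the basis element of degree $l$ comes out as a common
factor. With the mirror statement for $x-1$, this makes `diffOp_pochBasis` an identity of rational
functions. -/
theorem pochBasis_succ_add_one (b s x : A) (l : ℕ) :
    (x + b + s) * pochBasis b s (l + 1) (x + 1) =
      pochBasis b s l x * ((s - x - 1) * (x + s + b + l) * (x + s + b + l + 1)) := by
  have h1 : poch (s - (x + 1)) (l + 1) = (s - x - 1) * poch (s - x) l := by
    rw [poch_succ_left]; congr 1 <;> [ring; (congr 1; ring)]
  have h2 : (x + b + s) * poch (x + 1 + s + b) (l + 1) =
      poch (x + s + b) l * (x + s + b + l) * (x + s + b + l + 1) := by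
    have e : x + 1 + s + b = x + s + b + 1 := by ring
    have e' : x + b + s = x + s + b := by ring
    rw [e, e', ← poch_succ_left, poch_succ, poch_succ]; push_cast; ring
  simp only [pochBasis]
  linear_combination (poch (s - (x + 1)) (l + 1)) * h2 +
    poch (x + s + b) l * (x + s + b + l) * (x + s + b + l + 1) * h1

theorem pochBasis_succ_sub_one (b s x : A) (l : ℕ) :
    (s - x) * pochBasis b s (l + 1) (x - 1) =
      pochBasis b s l x * ((x + s + b - 1) * (s - x + l) * (s - x + l + 1)) := by
  have h1 : poch (x - 1 + s + b) (l + 1) = (x + s + b - 1) * poch (x + s + b) l := by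
    rw [poch_succ_left]; congr 1 <;> [ring; (congr 1; ring)]
  have h2 : (s - x) * poch (s - (x - 1)) (l + 1) =
      poch (s - x) l * (s - x + l) * (s - x + l + 1) := by
    have e : s - (x - 1) = s - x + 1 := by ring
    rw [e, ← poch_succ_left, poch_succ, poch_succ]; push_cast; ring
  simp only [pochBasis]
  linear_combination (poch (x - 1 + s + b) (l + 1)) * h2 +
    poch (s - x) l * (s - x + l) * (s - x + l + 1) * h1

/-- The factor of the multivariable Racah polynomial in the variable `x`, `M` being the next
variable. -/
noncomputable def racahFactor [Algebra ℝ A] (n : ℕ) (b₀ b b' s x M : A) : A :=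
  racahOne n (2 * s + b - b₀ - 1) (b' - b - 1) (s - M - 1) (s + b + M) (-s + x)

/-- The coefficients of `racahFactor` in the basis `pochBasis`. -/
noncomputable def racahCoeff [Algebra ℝ A] (n : ℕ) (b₀ b b' s M : A) (l : ℕ) : A :=
  ((l.factorial : ℝ)⁻¹) •
    (poch (-(n : A)) l * poch ((n : A) + 2 * s + b' - b₀ - 1) l *
      (poch (2 * s + b - b₀ + l) (n - l) * poch (s + b' + M + l) (n - l) *
        poch (s - M + l) (n - l)))

theorem racahFactor_eq_sum [Algebra ℝ A] (n : ℕ) (b₀ b b' s x M : A) :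
    racahFactor n b₀ b b' s x M =
      ∑ l ∈ Finset.range (n + 1), racahCoeff n b₀ b b' s M l * pochBasis b s l x := by
  unfold racahFactor racahOne
  refine Finset.sum_congr rfl fun l _ => ?_
  rw [racahCoeff, pochBasis, smul_mul_assoc]
  congr 1
  rw [show (n : A) + (2 * s + b - b₀ - 1) + (b' - b - 1) + 1 = n + 2 * s + b' - b₀ - 1 by ring,
    show -(-s + x) = s - x by ring, show -s + x + (s - M - 1) + (s + b + M) + 1 = x + s + b by ring,
    show 2 * s + b - b₀ - 1 + 1 + (l : A) = 2 * s + b - b₀ + l by ring,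
    show b' - b - 1 + (s + b + M) + 1 + (l : A) = s + b' + M + l by ring,
    show s - M - 1 + 1 + (l : A) = s - M + l by ring]
  ring

/-- $M$ enters only through $(s+b'+M+l)_{n-l}\,(s-M+l)_{n-l}$, and the reflection swaps the two
factors. -/
theorem racahFactor_symm [Algebra ℝ A] (n : ℕ) (b₀ b b' s x M : A) :
    racahFactor n b₀ b b' s x (-M - b') = racahFactor n b₀ b b' s x M := by
  rw [racahFactor_eq_sum, racahFactor_eq_sum]
  refine Finset.sum_congr rfl fun l _ => ?_
  rw [racahCoeff, racahCoeff, show s + b' + (-M - b') + (l : A) = s - M + l by ring,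
    show s - (-M - b') + (l : A) = s + b' + M + l by ring]
  congr 2
  ring

end OneVariable

/-! ### One-variable difference equation and contiguous relation -/

section Field

variable {K : Type*} [Field K]

/-- The action on the basis `pochBasis` of the one-variable difference operator obtained from the
quadratic polynomial `q₀ + q₁ u + q₂ u²`. -/
theorem diffOp_pochBasis (q₀ q₁ q₂ b₀ b s x : K) (l : ℕ) (h0 : 2 * x + b ≠ 0)
    (h1 : 2 * x + b + 1 ≠ 0) (h2 : 2 * x + b - 1 ≠ 0) (q : K → K)
    (hq : ∀ u, q u = q₀ + q₁ * u + q₂ * u ^ 2) :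
    q x / ((2 * x + b) * (2 * x + b + 1)) *
        ((x + b - b₀ + s) * (x + b + s) * pochBasis b s l (x + 1)
          - (x + b - b₀) * (x + b) * pochBasis b s l x) +
      q (-x - b) / ((2 * x + b) * (2 * x + b - 1)) *
        ((-x - b₀ + s) * (-x + s) * pochBasis b s l (x - 1)
          - (-x - b₀) * (-x) * pochBasis b s l x) +
      (q₂ - q x / ((2 * x + b) * (2 * x + b + 1)) - q (-x - b) / ((2 * x + b) * (2 * x + b - 1))) *
        (s * (s - 1 + b - b₀)) * pochBasis b s l x =
    (q₂ * (s + l) * (s + l - 1 - b₀) + q₁ * (s + l)) * pochBasis b s l x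
      - l * (2 * s + b - b₀ + l - 1) * q (s + l - 1) * pochBasis b s (l - 1) x := by
  -- Eliminating $b$ turns the denominators into the visibly nonzero $D$, $D+1$, $D-1$.
  obtain ⟨D, rfl⟩ : ∃ D, b = D - 2 * x := ⟨2 * x + b, by ring⟩
  have eD : 2 * x + (D - 2 * x) = D := by ring
  rw [eD] at h0 h1 h2
  rw [eD]
  cases l with
  | zero =>
    simp only [pochBasis_zero, hq]
    field_simp
    push_cast
    ring
  | succ m =>
    have e1 := pochBasis_succ_add_one (D - 2 * x) s x m
    have e2 := pochBasis_succ_sub_one (D - 2 * x) s x m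
    have e3 := pochBasis_succ (D - 2 * x) s x m
    have r1 : (x + (D - 2 * x) - b₀ + s) * (x + (D - 2 * x) + s) *
          pochBasis (D - 2 * x) s (m + 1) (x + 1) =
        (x + (D - 2 * x) - b₀ + s) * (pochBasis (D - 2 * x) s m x *
          ((s - x - 1) * (x + s + (D - 2 * x) + m) * (x + s + (D - 2 * x) + m + 1))) := by
      rw [← e1]; ring
    have r2 : (-x - b₀ + s) * (-x + s) * pochBasis (D - 2 * x) s (m + 1) (x - 1) =
        (-x - b₀ + s) * (pochBasis (D - 2 * x) s m x * ((x + s + (D - 2 * x) - 1) * (s - x + m) *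
          (s - x + m + 1))) := by rw [← e2]; ring
    rw [r1, r2, e3, Nat.add_sub_cancel]
    generalize pochBasis (D - 2 * x) s m x = P
    simp only [hq]
    push_cast
    field_simp
    ring

/-- If the coefficients of `f = ∑ c_l pochBasis l` satisfy a two-term relation, the operator acts
on the sum termwise. -/
theorem sum_range_pochBasis (n : ℕ) (c e : ℕ → K) (α γ : ℕ → K) (b s x : K)
    (hγ : γ 0 = 0) (hn : c n * α n = e n)
    (h : ∀ l < n, c l * α l + c (l + 1) * γ (l + 1) = e l) :
    ∑ l ∈ Finset.range (n + 1),
        c l * (α l * pochBasis b s l x + γ l * pochBasis b s (l - 1) x) =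
      ∑ l ∈ Finset.range (n + 1), e l * pochBasis b s l x := by
  simp only [mul_add, Finset.sum_add_distrib]
  rw [Finset.sum_range_succ' (fun l => c l * (γ l * _)), Finset.sum_range_succ,
    Finset.sum_range_succ (fun l => e l * _)]
  simp only [hγ, Nat.add_sub_cancel]
  have : ∑ l ∈ Finset.range n, c l * (α l * pochBasis b s l x) +
      ∑ l ∈ Finset.range n, c (l + 1) * (γ (l + 1) * pochBasis b s l x) =
      ∑ l ∈ Finset.range n, e l * pochBasis b s l x := by
    rw [← Finset.sum_add_distrib]
    refine Finset.sum_congr rfl fun l hl => ?_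
    rw [← h l (Finset.mem_range.mp hl)]; ring
  rw [← this, ← hn]; ring

variable [Algebra ℝ K]

/-- This is the ratio of consecutive hypergeometric terms, cross-multiplied so that no denominator
has to be nonzero. The factor $(n-l)(n+l+2s+b'-b_0-1)$ is the difference between the $l$-th diagonal
entry of the operator and the eigenvalue. -/
theorem racahCoeff_recurrence (n : ℕ) (b₀ b b' s M : K) (l : ℕ) (hl : l < n) :
    (n - l : K) * ((n : K) + l + 2 * s + b' - b₀ - 1) * racahCoeff n b₀ b b' s M l =
     - ((l + 1) * (2 * s + b - b₀ + l) * ((s + l + b' + M) * (s + l - M)) *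
        racahCoeff n b₀ b b' s M (l + 1)) := by
  obtain ⟨m, rfl⟩ := Nat.exists_eq_add_of_le hl
  have hf : ((l.factorial : ℝ)⁻¹) = ((l + 1 : ℕ) : ℝ) * (((l + 1).factorial : ℝ)⁻¹) := by
    rw [Nat.factorial_succ]
    have : (l.factorial : ℝ) ≠ 0 := by positivity
    push_cast
    field_simp
  rw [racahCoeff, racahCoeff, hf, show l.succ + m - l = m + 1 by omega,
    show l.succ + m - (l + 1) = m by omega]
  simp only [Algebra.smul_def, map_mul, map_natCast]
  rw [poch_succ_left (_ + (l : K)) m, poch_succ_left (s + b' + M + (l : K)) m,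
    poch_succ_left (s - M + (l : K)) m, poch_succ _ l, poch_succ _ l]
  push_cast
  simp only [← add_assoc]
  ring

/-- Replacing $M$ by $M+1$ alters the two $M$-dependent rising factorials only at their ends, so the
three coefficients share a large common factor. What remains is a polynomial identity, the
comparison of coefficients in the contiguous relation. -/
theorem racahCoeff_add_one (n : ℕ) (b₀ b b' s M : K) (l : ℕ) (hl : l < n) :
    (M + b' + s + l) * (M + b' + s + l - b₀) * racahCoeff n b₀ b b' s (M + 1) l
      - (l + 1) * (2 * s + b - b₀ + l) * ((s + l + (M + b')) * (s + l + (M + b') + 1)) *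
        racahCoeff n b₀ b b' s (M + 1) (l + 1) =
    (M + b' - b₀ + (s + n)) * (M + b' + (s + n)) * racahCoeff n b₀ b b' s M l := by
  obtain ⟨m, rfl⟩ := Nat.exists_eq_add_of_le hl
  have hf : ((l.factorial : ℝ)⁻¹) = ((l + 1 : ℕ) : ℝ) * (((l + 1).factorial : ℝ)⁻¹) := by
    rw [Nat.factorial_succ]
    have : (l.factorial : ℝ) ≠ 0 := by positivity
    push_cast
    field_simp
  rw [racahCoeff, racahCoeff, racahCoeff, hf, show l.succ + m - l = m + 1 by omega,
    show l.succ + m - (l + 1) = m by omega]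
  simp only [Algebra.smul_def, map_mul, map_natCast]
  have g1 : poch (s + b' + (M + 1) + (l : K)) (m + 1) =
      poch (s + b' + M + l + 1) m * (s + b' + M + l + 1 + m) := by
    rw [poch_succ]; congr 1 <;> [(congr 1; ring); ring]
  have g2 : (s + b' + M + l + 1) * poch (s + b' + (M + 1) + ((l + 1 : ℕ) : K)) m =
      poch (s + b' + M + l + 1) m * (s + b' + M + l + 1 + m) := by
    rw [← poch_succ, poch_succ_left]; congr 2; push_cast; ring
  have g3 : poch (s - (M + 1) + (l : K)) (m + 1) = (s - M - 1 + l) * poch (s - M + l) m := by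
    rw [poch_succ_left]; congr 1 <;> [ring; (congr 1; ring)]
  have g4 : poch (s - (M + 1) + ((l + 1 : ℕ) : K)) m = poch (s - M + l) m := by
    congr 1; push_cast; ring
  have g5 : poch (s - M + (l : K)) (m + 1) = poch (s - M + l) m * (s - M + l + m) := poch_succ _ _
  have g6 : poch (s + b' + M + (l : K)) (m + 1) = (s + b' + M + l) * poch (s + b' + M + l + 1) m :=
    poch_succ_left _ _
  have g7 : poch (2 * s + b - b₀ + ((l + 1 : ℕ) : K)) m = poch (2 * s + b - b₀ + l + 1) m := by
    congr 1; push_cast; ring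
  rw [g1, g3, g4, g5, g6, g7, poch_succ_left (_ + (l : K)) m, poch_succ _ l, poch_succ _ l]
  generalize poch (-((l.succ + m : ℕ) : K)) l = P1
  generalize poch ((l.succ + m : ℕ) + 2 * s + b' - b₀ - 1) l = P2
  generalize hP : poch (s + b' + M + l + 1) m = P3 at *
  generalize poch (s - M + l) m = P4
  generalize poch (2 * s + b - b₀ + l + 1) m = P5
  generalize algebraMap ℝ K ((l + 1).factorial : ℝ)⁻¹ = c
  push_cast at g2 ⊢
  -- The one rising factorial not yet written in the common factors is that of `g2`, known only
  -- after multiplication by $s+b'+M+l+1$. The term containing it carries this factor, so no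
  -- division is required.
  linear_combination (-(l + 1) * (2 * s + b - b₀ + l) * (s + l + (M + b')) * c * P1 *
    (-(l + 1 + m) + l) * P2 * (l + 1 + m + 2 * s + b' - b₀ - 1 + l) * P5 * P4) * g2

/-- The one-variable difference operator attached to `q`, with `g⁺ = g(x+1)`, `g⁻ = g(x-1)`. -/
noncomputable def diffOp (q : K → K) (q₂ b₀ b s x : K) (g gp gm : K) : K :=
  q x / ((2 * x + b) * (2 * x + b + 1)) *
      ((x + b - b₀ + s) * (x + b + s) * gp - (x + b - b₀) * (x + b) * g) +
    q (-x - b) / ((2 * x + b) * (2 * x + b - 1)) *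
      ((-x - b₀ + s) * (-x + s) * gm - (-x - b₀) * (-x) * g) +
    (q₂ - q x / ((2 * x + b) * (2 * x + b + 1)) - q (-x - b) / ((2 * x + b) * (2 * x + b - 1))) *
      (s * (s - 1 + b - b₀)) * g

theorem diffOp_racahFactor_eq_sum (q : K → K) (q₀ q₁ q₂ b₀ b b' s x M : K) (n : ℕ)
    (h0 : 2 * x + b ≠ 0) (h1 : 2 * x + b + 1 ≠ 0) (h2 : 2 * x + b - 1 ≠ 0)
    (hq : ∀ u, q u = q₀ + q₁ * u + q₂ * u ^ 2) :
    diffOp q q₂ b₀ b s x (racahFactor n b₀ b b' s x M) (racahFactor n b₀ b b' s (x + 1) M)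
        (racahFactor n b₀ b b' s (x - 1) M) =
      ∑ l ∈ Finset.range (n + 1), racahCoeff n b₀ b b' s M l *
        ((q₂ * (s + l) * (s + l - 1 - b₀) + q₁ * (s + l)) * pochBasis b s l x +
          (-(l * (2 * s + b - b₀ + l - 1) * q (s + l - 1))) * pochBasis b s (l - 1) x) := by
  have key : ∀ l, racahCoeff n b₀ b b' s M l *
        ((q₂ * (s + l) * (s + l - 1 - b₀) + q₁ * (s + l)) * pochBasis b s l x +
          (-(l * (2 * s + b - b₀ + l - 1) * q (s + l - 1))) * pochBasis b s (l - 1) x) =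
      diffOp q q₂ b₀ b s x (racahCoeff n b₀ b b' s M l * pochBasis b s l x)
        (racahCoeff n b₀ b b' s M l * pochBasis b s l (x + 1))
        (racahCoeff n b₀ b b' s M l * pochBasis b s l (x - 1)) := by
    intro l
    have := diffOp_pochBasis q₀ q₁ q₂ b₀ b s x l h0 h1 h2 q hq
    rw [neg_mul, ← sub_eq_add_neg, ← this, diffOp]
    ring
  simp only [key, racahFactor_eq_sum]
  -- The length of the sum is detached from the degree $n$ in the coefficients, so that linearity
  -- can be proved by induction on the number of terms.
  generalize n + 1 = m
  induction m with
  | zero => simp [diffOp]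
  | succ m ih => rw [Finset.sum_range_succ, Finset.sum_range_succ, Finset.sum_range_succ,
      Finset.sum_range_succ, ← ih]; simp only [diffOp]; ring

/-- The difference equation of the one-variable Racah polynomials. -/
theorem diffOp_racahFactor (b₀ b b' s x M : K) (n : ℕ)
    (h0 : 2 * x + b ≠ 0) (h1 : 2 * x + b + 1 ≠ 0) (h2 : 2 * x + b - 1 ≠ 0) :
    diffOp (fun u => (u + b' + M) * (M - u)) (-1) b₀ b s x (racahFactor n b₀ b b' s x M)
        (racahFactor n b₀ b b' s (x + 1) M) (racahFactor n b₀ b b' s (x - 1) M) =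
      -((s + n) * (s + n - 1 + b' - b₀)) * racahFactor n b₀ b b' s x M := by
  rw [diffOp_racahFactor_eq_sum _ (M * (M + b')) (-b') (-1) b₀ b b' s x M n h0 h1 h2
    (fun u => by ring), racahFactor_eq_sum, Finset.mul_sum]
  refine (sum_range_pochBasis n _ (fun l => -((s + n) * (s + n - 1 + b' - b₀)) *
    racahCoeff n b₀ b b' s M l) (fun l => -1 * (s + l) * (s + l - 1 - b₀) + -b' * (s + l))
    (fun l => -(l * (2 * s + b - b₀ + l - 1) * ((s + l - 1 + b' + M) * (M - (s + l - 1)))))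
    b s x ?_ ?_ ?_).trans (Finset.sum_congr rfl fun l _ => by ring)
  · simp
  · ring
  · intro l hl
    have := racahCoeff_recurrence n b₀ b b' s M l hl
    push_cast
    linear_combination this

/-- A contiguous relation lowering the parameter `M` of the one-variable Racah polynomials. -/
theorem diffOp_racahFactor_add_one (b₀ b b' s x M : K) (n : ℕ)
    (h0 : 2 * x + b ≠ 0) (h1 : 2 * x + b + 1 ≠ 0) (h2 : 2 * x + b - 1 ≠ 0) :
    (M + b' - b₀) * (M + b') * racahFactor n b₀ b b' s x (M + 1) +
      diffOp (fun u => (M + u + b') * (M + u + b' + 1)) 1 b₀ b s x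
        (racahFactor n b₀ b b' s x (M + 1)) (racahFactor n b₀ b b' s (x + 1) (M + 1))
        (racahFactor n b₀ b b' s (x - 1) (M + 1)) =
      (M + b' - b₀ + (s + n)) * (M + b' + (s + n)) * racahFactor n b₀ b b' s x M := by
  rw [diffOp_racahFactor_eq_sum _ ((M + b') * (M + b' + 1)) (2 * (M + b') + 1) 1 b₀ b b' s x
    (M + 1) n h0 h1 h2 (fun u => by ring), racahFactor_eq_sum, racahFactor_eq_sum, Finset.mul_sum,
    Finset.mul_sum, ← eq_sub_iff_add_eq', ← Finset.sum_sub_distrib]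
  refine (sum_range_pochBasis n _ (fun l => (M + b' - b₀ + (s + n)) * (M + b' + (s + n)) *
    racahCoeff n b₀ b b' s M l - (M + b' - b₀) * (M + b') * racahCoeff n b₀ b b' s (M + 1) l)
    (fun l => 1 * (s + l) * (s + l - 1 - b₀) + (2 * (M + b') + 1) * (s + l))
    (fun l => -(l * (2 * s + b - b₀ + l - 1) *
      ((M + (s + l - 1) + b') * (M + (s + l - 1) + b' + 1))))
    b s x ?_ ?_ ?_).trans (Finset.sum_congr rfl fun l _ => by ring)
  · simp
  -- For $l=n$ the $M$-dependent products are empty, so the top coefficient does not change with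
  -- $M$.
  · have : racahCoeff n b₀ b b' s (M + 1) n = racahCoeff n b₀ b b' s M n := by
      simp [racahCoeff]
    rw [this]; ring
  · intro l hl
    have := racahCoeff_add_one n b₀ b b' s M l hl
    push_cast
    linear_combination this

end Field

/-! ### The recursive operator and its action on products of Racah factors -/

section Chain

variable {K : Type*} [Field K] [Algebra ℝ K]

/-- Commuting unit shifts `σ i` of variables `x i`, `i < p`, in a field, together with constants
`b₀` and `b i`; no `2 x i + b i` is an integer. -/
structure IsShiftSystem (p : ℕ) (σ : ℕ → K ≃ₐ[ℝ] K) (x b : ℕ → K) (b₀ : K) : Prop where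
  shift_self : ∀ i < p, σ i (x i) = x i + 1
  shift_of_ne : ∀ i < p, ∀ k, k ≠ i → σ i (x k) = x k
  shift_const : ∀ i < p, ∀ k, σ i (b k) = b k
  shift_const_zero : ∀ i < p, σ i b₀ = b₀
  ne_zero : ∀ i < p, ∀ m : ℤ, 2 * x i + b i + m ≠ 0

variable (σ : ℕ → K ≃ₐ[ℝ] K) (x b : ℕ → K) (b₀ : K)

/-- The Racah operator in the first `k` variables, with an arbitrary function `q` of the last
active variable in place of the factors containing `M`. -/
noncomputable def chainOp : ℕ → (K → K) → K → K
  | 0, _, _ => 0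
  | k + 1, q, f =>
    chainOp k q f +
      q (x k) * (((x k + b k - b₀) * (x k + b k) * (σ k f - f) +
        chainOp k (fun u => (x k + u + b k) * (x k + u + b k + 1)) (σ k f - f)) /
          ((2 * x k + b k) * (2 * x k + b k + 1))) +
      q (-x k - b k) * ((((-x k - b k) + b k - b₀) * ((-x k - b k) + b k) * ((σ k).symm f - f) +
        chainOp k (fun u => ((-x k - b k) + u + b k) * ((-x k - b k) + u + b k + 1))
          ((σ k).symm f - f)) /
          ((2 * (-x k - b k) + b k) * (2 * (-x k - b k) + b k + 1)))

variable {σ x b b₀}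

theorem chainOp_add (k : ℕ) (q : K → K) (f g : K) :
    chainOp σ x b b₀ k q (f + g) = chainOp σ x b b₀ k q f + chainOp σ x b b₀ k q g := by
  induction k generalizing q f g with
  | zero => simp [chainOp]
  | succ k ih =>
    simp only [chainOp, map_add, add_sub_add_comm, ih]
    ring

/-- In the recursion $q$ is never passed to an inner operator acting on a shifted difference; it
occurs only as an outer factor. Hence linearity in $q$, which is what makes interpolation of $q$
useful. -/
theorem chainOp_add_left (k : ℕ) (q r : K → K) (f : K) :
    chainOp σ x b b₀ k (fun u => q u + r u) f =
      chainOp σ x b b₀ k q f + chainOp σ x b b₀ k r f := by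
  induction k with
  | zero => simp [chainOp]
  | succ k ih => simp only [chainOp, ih]; ring

theorem chainOp_mul_left (k : ℕ) (c : K) (q : K → K) (f : K) :
    chainOp σ x b b₀ k (fun u => c * q u) f = c * chainOp σ x b b₀ k q f := by
  induction k with
  | zero => simp [chainOp]
  | succ k ih => simp only [chainOp, ih]; ring

theorem chainOp_mul (k : ℕ) (c : K) (hc : ∀ i < k, σ i c = c) (q : K → K) (f : K) :
    chainOp σ x b b₀ k q (c * f) = c * chainOp σ x b b₀ k q f := by
  induction k generalizing q f with
  | zero => simp [chainOp]
  | succ k ih =>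
    have h1 : (σ k) c = c := hc k k.lt_succ_self
    have h2 : (σ k).symm c = c := by rw [AlgEquiv.symm_apply_eq, h1]
    have ih' := ih fun i hi => hc i (hi.trans k.lt_succ_self)
    simp only [chainOp, map_mul, h1, h2, ← mul_sub, ih']
    ring

theorem chainOp_sub (k : ℕ) (q : K → K) (f g : K) :
    chainOp σ x b b₀ k q (f - g) = chainOp σ x b b₀ k q f - chainOp σ x b b₀ k q g := by
  rw [eq_sub_iff_add_eq, ← chainOp_add, sub_add_cancel]

/-- Lagrange interpolation of the quadratic function `q`. -/
theorem chainOp_interpolate (k : ℕ) (q : K → K) (q₀ q₁ q₂ y c f : K) (h0 : 2 * y + c ≠ 0)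
    (h1 : 2 * y + c + 1 ≠ 0) (h2 : 2 * y + c - 1 ≠ 0)
    (hq : ∀ u, q u = q₀ + q₁ * u + q₂ * u ^ 2) :
    chainOp σ x b b₀ k q f =
      q y / ((2 * y + c) * (2 * y + c + 1)) *
        chainOp σ x b b₀ k (fun u => (y + u + c) * (y + u + c + 1)) f +
      q (-y - c) / ((2 * y + c) * (2 * y + c - 1)) *
        chainOp σ x b b₀ k (fun u => (-y - c + u + c) * (-y - c + u + c + 1)) f +
      -(q₂ - q y / ((2 * y + c) * (2 * y + c + 1)) - q (-y - c) / ((2 * y + c) * (2 * y + c - 1))) *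
        chainOp σ x b b₀ k (fun u => (u + c + y) * (y - u)) f := by
  rw [← chainOp_mul_left, ← chainOp_mul_left, ← chainOp_mul_left, ← chainOp_add_left,
    ← chainOp_add_left]
  congr 1
  funext u
  obtain ⟨D, rfl⟩ : ∃ D, c = D - 2 * y := ⟨2 * y + c, by ring⟩
  have eD : 2 * y + (D - 2 * y) = D := by ring
  rw [eD] at h0 h1 h2 ⊢
  simp only [hq]
  field_simp
  ring

variable (x b b₀) in
/-- The product of the first `k` factors of the multivariable Racah polynomial, with `M` in place
of the variable `x k`. -/
noncomputable def racahPrefix (n : ℕ → ℕ) : ℕ → K → K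
  | 0, _ => 1
  | k + 1, M => racahPrefix n k (x k) *
      racahFactor (n k) b₀ (b k) (b (k + 1)) ((∑ i ∈ Finset.range k, n i : ℕ) : K) (x k) M

theorem racahPrefix_symm (n : ℕ → ℕ) (k : ℕ) (M : K) :
    racahPrefix x b b₀ n k (-M - b k) = racahPrefix x b b₀ n k M := by
  cases k with
  | zero => rfl
  | succ k => rw [racahPrefix, racahPrefix, racahFactor_symm]

theorem map_racahFactor {A B : Type*} [CommRing A] [CommRing B] [Algebra ℝ A] [Algebra ℝ B]
    (φ : A →ₐ[ℝ] B) (n : ℕ) (b₀ b b' s x M : A) :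
    φ (racahFactor n b₀ b b' s x M) =
      racahFactor n (φ b₀) (φ b) (φ b') (φ s) (φ x) (φ M) := by
  simp only [racahFactor, map_racahOne, map_sub, map_add, map_mul, map_neg, map_one, map_ofNat]

theorem map_racahPrefix (φ : K →ₐ[ℝ] K) (n : ℕ → ℕ) (k : ℕ) (M : K) (hb₀ : φ b₀ = b₀)
    (hb : ∀ i, φ (b i) = b i) (hx : ∀ i < k, φ (x i) = x i) :
    φ (racahPrefix x b b₀ n k M) = racahPrefix x b b₀ n k (φ M) := by
  induction k generalizing M with
  | zero => simp [racahPrefix]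
  | succ k ih =>
    rw [racahPrefix, map_mul, ih _ (fun i hi => hx i (hi.trans k.lt_succ_self)), map_racahFactor,
      hb₀, hb, hb, hx k k.lt_succ_self, map_natCast, racahPrefix]

variable {p : ℕ}

/-- Interpolating $q$ in the term $g\cdot{}$`chainOp k q R` produces exactly the unshifted terms
that the differences $E^{\pm1}-1$ subtract, and these cancel. The shifted terms are evaluated by
`h1` and `h2`, the third interpolating function by `h0`, and $R$ factors out. -/
theorem IsShiftSystem.chainOp_succ_mul (H : IsShiftSystem p σ x b b₀) {k : ℕ} (hk : k < p)
    (q : K → K) (q₀ q₁ q₂ : K) (hq : ∀ u, q u = q₀ + q₁ * u + q₂ * u ^ 2) (s R g : K)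
    (hg : ∀ i < k, σ i g = g) (hg' : ∀ i < k, σ i (σ k g) = σ k g)
    (hg'' : ∀ i < k, σ i ((σ k).symm g) = (σ k).symm g)
    (h0 : chainOp σ x b b₀ k (fun u => (u + b k + x k) * (x k - u)) R =
      -(s * (s - 1 + b k - b₀)) * R)
    (h1 : (x k + b k) * (x k + b k - b₀) * σ k R +
        chainOp σ x b b₀ k (fun u => (x k + u + b k) * (x k + u + b k + 1)) (σ k R) =
      (x k + b k - b₀ + s) * (x k + b k + s) * R)
    (h2 : ((-x k - b k) + b k) * ((-x k - b k) + b k - b₀) * (σ k).symm R +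
        chainOp σ x b b₀ k (fun u => ((-x k - b k) + u + b k) * ((-x k - b k) + u + b k + 1))
          ((σ k).symm R) =
      ((-x k - b k) + b k - b₀ + s) * ((-x k - b k) + b k + s) * R) :
    chainOp σ x b b₀ (k + 1) q (R * g) =
      R * diffOp q q₂ b₀ (b k) s (x k) g (σ k g) ((σ k).symm g) := by
  have n0 : 2 * x k + b k ≠ 0 := by simpa using H.ne_zero k hk 0
  have n1 : 2 * x k + b k + 1 ≠ 0 := by simpa using H.ne_zero k hk 1
  have n2 : 2 * x k + b k - 1 ≠ 0 := by simpa [sub_eq_add_neg] using H.ne_zero k hk (-1)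
  have eD : (2 * (-x k - b k) + b k) * (2 * (-x k - b k) + b k + 1) =
      (2 * x k + b k) * (2 * x k + b k - 1) := by ring
  rw [mul_comm R g, chainOp, eD, map_mul, map_mul, chainOp_sub, chainOp_sub, chainOp_mul _ _ hg,
    chainOp_mul _ _ hg, chainOp_mul _ _ hg', chainOp_mul _ _ hg'', chainOp_mul _ _ hg]
  rw [chainOp_interpolate k q q₀ q₁ q₂ (x k) (b k) R n0 n1 n2 hq, h0]
  rw [← eq_sub_iff_add_eq'] at h1 h2
  rw [h1, h2, diffOp]
  ring

/-- Neither relation can be proved alone: the step to $k+1$ for either one uses the eigenvalue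
equation at $M=x_k$ and the contiguous relation at both $M=x_k$ and $M=-x_k-b_k$. -/
theorem IsShiftSystem.chainOp_racahPrefix (H : IsShiftSystem p σ x b b₀) (n : ℕ → ℕ) {k : ℕ}
    (hk : k ≤ p) (M : K) (hM : ∀ i < k, σ i M = M) :
    chainOp σ x b b₀ k (fun u => (u + b k + M) * (M - u)) (racahPrefix x b b₀ n k M) =
      -(((∑ i ∈ Finset.range k, n i : ℕ) : K) *
        (((∑ i ∈ Finset.range k, n i : ℕ) : K) - 1 + b k - b₀)) * racahPrefix x b b₀ n k M ∧
    (M + b k) * (M + b k - b₀) * racahPrefix x b b₀ n k (M + 1) +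
        chainOp σ x b b₀ k (fun u => (M + u + b k) * (M + u + b k + 1))
          (racahPrefix x b b₀ n k (M + 1)) =
      (M + b k - b₀ + (∑ i ∈ Finset.range k, n i : ℕ)) *
        (M + b k + (∑ i ∈ Finset.range k, n i : ℕ)) * racahPrefix x b b₀ n k M := by
  induction k generalizing M with
  | zero => simp [chainOp, racahPrefix]; ring
  | succ k ih =>
    have hk' : k < p := hk
    have hxk : ∀ i < k, σ i (x k) = x k := fun i hi =>
      H.shift_of_ne i (hi.trans hk') k (Nat.ne_of_gt hi)
    have hbk : ∀ i < k, σ i (b k) = b k := fun i hi => H.shift_const i (hi.trans hk') k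
    have n0 : 2 * x k + b k ≠ 0 := by simpa using H.ne_zero k hk' 0
    have n1 : 2 * x k + b k + 1 ≠ 0 := by simpa using H.ne_zero k hk' 1
    have n2 : 2 * x k + b k - 1 ≠ 0 := by simpa [sub_eq_add_neg] using H.ne_zero k hk' (-1)
    obtain ⟨ihE, ihP⟩ := ih hk'.le (x k) hxk
    have ihM := (ih hk'.le (-x k - b k) fun i hi => by
      rw [map_sub, map_neg, hxk i hi, hbk i hi]).2
    have sx : (σ k).symm (x k) = x k - 1 := by
      rw [AlgEquiv.symm_apply_eq, map_sub, H.shift_self k hk', map_one, add_sub_cancel_right]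
    have sc : ∀ c, σ k c = c → (σ k).symm c = c := fun c hc => by rw [AlgEquiv.symm_apply_eq, hc]
    have hRp : σ k (racahPrefix x b b₀ n k (x k)) = racahPrefix x b b₀ n k (x k + 1) := by
      rw [← H.shift_self k hk']
      exact map_racahPrefix (σ k : K →ₐ[ℝ] K) n k (x k) (H.shift_const_zero k hk')
        (H.shift_const k hk') fun i hi => H.shift_of_ne k hk' i hi.ne
    have hRm : (σ k).symm (racahPrefix x b b₀ n k (x k)) = racahPrefix x b b₀ n k (x k - 1) := by
      rw [← sx]
      exact map_racahPrefix ((σ k).symm : K →ₐ[ℝ] K) n k (x k) (sc _ (H.shift_const_zero k hk'))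
        (fun i => sc _ (H.shift_const k hk' i))
        fun i hi => sc _ (H.shift_of_ne k hk' i hi.ne)
    -- By reflection symmetry, raising $M$ at the reflected point $-x_k-b_k$ is the backward shift
    -- of $x_k$.
    have e1 : racahPrefix x b b₀ n k (-x k - b k + 1) = racahPrefix x b b₀ n k (x k - 1) := by
      rw [← racahPrefix_symm n k (x k - 1)]; congr 1; ring
    rw [e1, racahPrefix_symm, ← hRm] at ihM
    rw [← hRp] at ihP
    set s : K := ((∑ i ∈ Finset.range k, n i : ℕ) : K) with hs
    -- For every quadratic $q$ the problem becomes one-variable; the two conclusions are the two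
    -- choices of $q$.
    have main : ∀ (M : K), (∀ i < k + 1, σ i M = M) → ∀ (q : K → K) (q₀ q₁ q₂ : K),
        (∀ u, q u = q₀ + q₁ * u + q₂ * u ^ 2) →
        chainOp σ x b b₀ (k + 1) q (racahPrefix x b b₀ n (k + 1) M) =
          racahPrefix x b b₀ n k (x k) * diffOp q q₂ b₀ (b k) s (x k)
            (racahFactor (n k) b₀ (b k) (b (k + 1)) s (x k) M)
            (racahFactor (n k) b₀ (b k) (b (k + 1)) s (x k + 1) M)
            (racahFactor (n k) b₀ (b k) (b (k + 1)) s (x k - 1) M) := by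
      intro M hM q q₀ q₁ q₂ hq
      have hfac : ∀ i < k, ∀ y, σ i y = y →
          σ i (racahFactor (n k) b₀ (b k) (b (k + 1)) s y M) =
            racahFactor (n k) b₀ (b k) (b (k + 1)) s y M := by
        intro i hi y hy
        have := map_racahFactor (σ i : K →ₐ[ℝ] K) (n k) b₀ (b k) (b (k + 1)) s y M
        simpa [hy, hM i (hi.trans k.lt_succ_self), H.shift_const i (hi.trans hk'),
          H.shift_const_zero i (hi.trans hk'), hs] using this
      have hgp : σ k (racahFactor (n k) b₀ (b k) (b (k + 1)) s (x k) M) =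
          racahFactor (n k) b₀ (b k) (b (k + 1)) s (x k + 1) M := by
        have := map_racahFactor (σ k : K →ₐ[ℝ] K) (n k) b₀ (b k) (b (k + 1)) s (x k) M
        simpa [hM k k.lt_succ_self, H.shift_const k hk', H.shift_self k hk',
          H.shift_const_zero k hk', hs] using this
      have hgm : (σ k).symm (racahFactor (n k) b₀ (b k) (b (k + 1)) s (x k) M) =
          racahFactor (n k) b₀ (b k) (b (k + 1)) s (x k - 1) M := by
        have := map_racahFactor ((σ k).symm : K →ₐ[ℝ] K) (n k) b₀ (b k) (b (k + 1)) s (x k) M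
        simpa [sc _ (hM k k.lt_succ_self), sc _ (H.shift_const k hk' _), sx,
          sc _ (H.shift_const_zero k hk'), hs] using this
      rw [racahPrefix, ← hs, ← hgp, ← hgm]
      refine H.chainOp_succ_mul hk' q q₀ q₁ q₂ hq s _ _ ?_ ?_ ?_ ihE ihP ihM
      · exact fun i hi => hfac i hi _ (hxk i hi)
      · intro i hi
        rw [hgp]
        exact hfac i hi _ (by rw [map_add, hxk i hi, map_one])
      · intro i hi
        rw [hgm]
        exact hfac i hi _ (by rw [map_sub, hxk i hi, map_one])
    rw [Finset.sum_range_succ, Nat.cast_add, ← hs]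
    constructor
    · rw [main M hM _ (M * (M + b (k + 1))) (-b (k + 1)) (-1) fun u => by ring,
        diffOp_racahFactor _ _ _ _ _ _ _ n0 n1 n2, racahPrefix]
      ring
    · rw [main (M + 1) (fun i hi => by rw [map_add, hM i hi, map_one]) _
        ((M + b (k + 1)) * (M + b (k + 1) + 1)) (2 * (M + b (k + 1)) + 1) 1 fun u => by ring]
      have := diffOp_racahFactor_add_one b₀ (b k) (b (k + 1)) s (x k) M (n k) n0 n1 n2
      rw [racahPrefix, racahPrefix, ← hs]
      linear_combination racahPrefix x b b₀ n k (x k) * this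

end Chain

/-! ### The coefficients along the chain of active variables -/

section ChainCoeff

variable {ι κ K : Type*} [LinearOrder ι] [LinearOrder κ] [Field K]

/-- The product of `h a c` over the pairs of consecutive elements `a < c` of `S`. -/
noncomputable def consecProd (h : ι → ι → K) (S : Finset ι) : K :=
  ∏ c ∈ S, if hc : (S.filter (· < c)).Nonempty then h ((S.filter (· < c)).max' hc) c else 1

/-- The coefficient `A_ν`, with an arbitrary function `q` of the last active variable in place of
the factors containing `M`. -/
noncomputable def chainCoeff (ξ b : ι → K) (b₀ : K) (q : K → K) (S : Finset ι) : K :=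
  if hS : S.Nonempty then
    (ξ (S.min' hS) + b (S.min' hS) - b₀) * (ξ (S.min' hS) + b (S.min' hS)) *
      (consecProd (fun a c => (ξ c + ξ a + b c) * (ξ c + ξ a + b c + 1)) S /
        ∏ i ∈ S, (2 * ξ i + b i) * (2 * ξ i + b i + 1)) * q (ξ (S.max' hS))
  else 0

theorem max'_map_orderEmbedding (e : ι ↪o κ) (S : Finset ι) (h : (S.map e.toEmbedding).Nonempty)
    (h' : S.Nonempty) : (S.map e.toEmbedding).max' h = e (S.max' h') := by
  rw [Finset.max'_eq_iff]
  refine ⟨Finset.mem_map_of_mem _ (S.max'_mem h'), fun c hc => ?_⟩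
  obtain ⟨a, ha, rfl⟩ := Finset.mem_map.mp hc
  exact e.monotone (S.le_max' a ha)

theorem min'_map_orderEmbedding (e : ι ↪o κ) (S : Finset ι) (h : (S.map e.toEmbedding).Nonempty)
    (h' : S.Nonempty) : (S.map e.toEmbedding).min' h = e (S.min' h') := by
  rw [Finset.min'_eq_iff]
  refine ⟨Finset.mem_map_of_mem _ (S.min'_mem h'), fun c hc => ?_⟩
  obtain ⟨a, ha, rfl⟩ := Finset.mem_map.mp hc
  exact e.monotone (S.min'_le a ha)

theorem consecProd_map (e : ι ↪o κ) (h : κ → κ → K) (S : Finset ι) :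
    consecProd h (S.map e.toEmbedding) = consecProd (fun a c => h (e a) (e c)) S := by
  rw [consecProd, consecProd, Finset.prod_map]
  refine Finset.prod_congr rfl fun c _ => ?_
  have hf : (S.map e.toEmbedding).filter (· < e.toEmbedding c) =
      (S.filter (· < c)).map e.toEmbedding := by
    rw [Finset.filter_map]
    congr 1
    ext a
    simp
  simp only [hf, Finset.map_nonempty]
  by_cases hc : (S.filter (· < c)).Nonempty
  · rw [dif_pos hc, dif_pos hc, max'_map_orderEmbedding e _ _ hc]
    rfl
  · rw [dif_neg hc, dif_neg hc]

theorem chainCoeff_map (e : ι ↪o κ) (ξ b : κ → K) (b₀ : K) (q : K → K) (S : Finset ι) :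
    chainCoeff ξ b b₀ q (S.map e.toEmbedding) =
      chainCoeff (fun i => ξ (e i)) (fun i => b (e i)) b₀ q S := by
  by_cases hS : S.Nonempty
  · have hS' : (S.map e.toEmbedding).Nonempty := Finset.map_nonempty.mpr hS
    rw [chainCoeff, chainCoeff, dif_pos hS, dif_pos hS', max'_map_orderEmbedding e _ _ hS,
      min'_map_orderEmbedding e _ _ hS, consecProd_map, Finset.prod_map]
    rfl
  · rw [chainCoeff, chainCoeff, dif_neg hS, dif_neg (by simpa using hS)]

theorem consecProd_insert (h : ι → ι → K) (S : Finset ι) (m : ι) (hm : ∀ i ∈ S, i < m)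
    (hS : S.Nonempty) : consecProd h (insert m S) = h (S.max' hS) m * consecProd h S := by
  have hmS : m ∉ S := fun hmS => lt_irrefl m (hm m hmS)
  rw [consecProd, Finset.prod_insert hmS]
  have e1 : (insert m S).filter (· < m) = S := by
    rw [Finset.filter_insert, if_neg (lt_irrefl m), Finset.filter_eq_self]
    exact hm
  simp only [e1, dif_pos hS]
  congr 1
  refine Finset.prod_congr rfl fun c hc => ?_
  have e2 : (insert m S).filter (· < c) = S.filter (· < c) := by
    rw [Finset.filter_insert, if_neg (hm c hc).not_gt]
  simp only [e2]

/-- Splitting off the last element of the support. -/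
theorem chainCoeff_insert (ξ b : ι → K) (b₀ : K) (q : K → K) (S : Finset ι) (m : ι)
    (hm : ∀ i ∈ S, i < m) :
    chainCoeff ξ b b₀ q (insert m S) =
      q (ξ m) * (((if S = ∅ then (ξ m + b m - b₀) * (ξ m + b m) else 0) +
        chainCoeff ξ b b₀ (fun u => (ξ m + u + b m) * (ξ m + u + b m + 1)) S) /
          ((2 * ξ m + b m) * (2 * ξ m + b m + 1))) := by
  have hmS : m ∉ S := fun hmS => lt_irrefl m (hm m hmS)
  rcases S.eq_empty_or_nonempty with rfl | hS
  · have h1 : consecProd (fun a c => (ξ c + ξ a + b c) * (ξ c + ξ a + b c + 1)) {m} = 1 := by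
      rw [consecProd, Finset.prod_singleton, dif_neg (by simp)]
    simp only [chainCoeff, insert_empty_eq, Finset.singleton_nonempty, dif_pos, h1,
      Finset.min'_singleton, Finset.max'_singleton, Finset.prod_singleton, if_true,
      Finset.not_nonempty_empty, dif_neg, not_false_eq_true, div_eq_mul_inv, mul_inv]
    ring
  · have hmax : (insert m S).max' (Finset.insert_nonempty m S) = m := by
      rw [Finset.max'_eq_iff]
      refine ⟨Finset.mem_insert_self m S, fun c hc => ?_⟩
      rcases Finset.mem_insert.mp hc with rfl | hc
      exacts [le_rfl, (hm c hc).le]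
    have hmin : (insert m S).min' (Finset.insert_nonempty m S) = S.min' hS := by
      rw [Finset.min'_eq_iff]
      refine ⟨Finset.mem_insert_of_mem (S.min'_mem hS), fun c hc => ?_⟩
      rcases Finset.mem_insert.mp hc with rfl | hc
      exacts [(hm _ (S.min'_mem hS)).le, S.min'_le c hc]
    rw [chainCoeff, dif_pos (Finset.insert_nonempty m S), hmax, hmin, if_neg hS.ne_empty,
      chainCoeff, dif_pos hS, consecProd_insert _ S m hm hS, Finset.prod_insert hmS]
    simp only [div_eq_mul_inv, mul_inv]
    ring

end ChainCoeff

/-! ### The sum over sign vectors equals the recursive operator -/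

section ChainSum

variable {K : Type*} [Field K] [Algebra ℝ K] (σ : ℕ → K ≃ₐ[ℝ] K) (x b : ℕ → K) (b₀ : K)

/-- `E_{x_i} - 1`, `E_{x_i}⁻¹ - 1` or the identity, according to the sign `a`. -/
noncomputable def signDiff (a : SignType) (i : ℕ) : Module.End ℝ K :=
  if a = 1 then (σ i).toLinearMap - 1 else if a = -1 then (σ i).symm.toLinearMap - 1 else 1

/-- The variable `x_i`, reflected if the sign `a` is negative. -/
noncomputable def signVar (a : SignType) (i : ℕ) : K := if a = -1 then -x i - b i else x i

/-- The sign vectors are grouped by their last entry. Entry $0$ reproduces the sum for the remaining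
variables; entries $\pm1$ are reduced by `chainCoeff_insert`, with $x_j$ or its reflection as the
new last active variable. -/
theorem sum_chainCoeff_eq_chainOp (j : ℕ) (q : K → K) (f : K) :
    ∑ ν : Fin j → SignType,
      chainCoeff (fun i : Fin j => signVar x b (ν i) i) (fun i => b i) b₀ q
        (Finset.univ.filter fun i => ν i ≠ 0) *
      (List.ofFn fun i : Fin j => signDiff σ (ν i) i).prod f =
    chainOp σ x b b₀ j q f := by
  induction j generalizing q f with
  | zero => simp [chainOp, chainCoeff]
  | succ j ih =>
    obtain ⟨e, he⟩ : ∃ e : Fin j ↪o Fin (j + 1), ∀ i, e i = i.castSucc :=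
      ⟨Fin.castSuccOrderEmb, fun _ => rfl⟩
    have hinj : ∀ ν : Fin j → SignType, ∀ a : SignType,
        (Finset.univ.filter fun i : Fin (j + 1) =>
          (Fin.snoc (α := fun _ => SignType) ν a : Fin (j + 1) → SignType) i ≠ 0) =
        if a = 0 then (Finset.univ.filter fun i => ν i ≠ 0).map e.toEmbedding
        else insert (Fin.last j)
          ((Finset.univ.filter fun i => ν i ≠ 0).map e.toEmbedding) := by
      intro ν a
      ext i
      induction i using Fin.lastCases with
      | last => by_cases ha : a = 0 <;> simp [ha, he, Fin.castSucc_ne_last]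
      | cast i => by_cases ha : a = 0 <;> simp [ha, he, Fin.castSucc_ne_last]
    have hlast : ∀ ν : Fin j → SignType,
        ∀ i ∈ (Finset.univ.filter fun i => ν i ≠ 0).map e.toEmbedding,
          i < Fin.last j := by
      intro ν i hi
      obtain ⟨k, _, rfl⟩ := Finset.mem_map.mp hi
      rw [RelEmbedding.coe_toEmbedding, he]
      exact Fin.castSucc_lt_last k
    -- Only $\nu=0$ has empty support. It accounts for the term in which the last variable is also
    -- the first active one.
    have hempty : ∀ g : K, ∀ c : K, ∑ ν : Fin j → SignType,
        (if (Finset.univ.filter fun i => ν i ≠ 0).map e.toEmbedding = ∅ then c else 0) *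
          (List.ofFn fun i : Fin j => signDiff σ (ν i) i).prod g = c * g := by
      intro g c
      rw [Finset.sum_eq_single 0]
      · simp [signDiff]
      · intro ν _ hν
        rw [if_neg, zero_mul]
        rw [Finset.map_eq_empty, Finset.filter_eq_empty_iff]
        contrapose! hν
        funext i
        simpa using hν (Finset.mem_univ i)
      · simp
    rw [← (Fin.snocEquiv fun _ : Fin (j + 1) => SignType).sum_comp, Fintype.sum_prod_type]
    have hrest : ∀ a : SignType, a ≠ 0 → ∑ ν : Fin j → SignType,
        chainCoeff (fun i : Fin (j + 1) =>
            signVar x b ((Fin.snocEquiv fun _ : Fin (j + 1) => SignType) (a, ν) i) i)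
          (fun i => b i) b₀ q (Finset.univ.filter fun i =>
            (Fin.snocEquiv fun _ : Fin (j + 1) => SignType) (a, ν) i ≠ 0) *
        (List.ofFn fun i : Fin (j + 1) =>
          signDiff σ ((Fin.snocEquiv fun _ : Fin (j + 1) => SignType) (a, ν) i) i).prod f =
        q (signVar x b a j) * (((signVar x b a j + b j - b₀) * (signVar x b a j + b j) *
          signDiff σ a j f + chainOp σ x b b₀ j (fun u => (signVar x b a j + u + b j) *
            (signVar x b a j + u + b j + 1)) (signDiff σ a j f)) /
          ((2 * signVar x b a j + b j) * (2 * signVar x b a j + b j + 1))) := by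
      intro a ha
      rw [← ih, ← hempty (signDiff σ a j f) ((signVar x b a j + b j - b₀) *
        (signVar x b a j + b j)), ← Finset.sum_add_distrib, Finset.sum_div, Finset.mul_sum]
      refine Finset.sum_congr rfl fun ν _ => ?_
      rw [List.ofFn_succ']
      simp only [Fin.snocEquiv_apply, hinj ν a, if_neg ha, List.concat_eq_append, List.prod_append,
        List.prod_singleton, chainCoeff_insert _ _ _ _ _ _ (hlast ν), chainCoeff_map,
        Fin.snoc_last, Fin.snoc_castSucc, Module.End.mul_apply, Fin.val_last,
        he, Fin.val_castSucc]
      ring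
    have hzero : ∑ ν : Fin j → SignType,
        chainCoeff (fun i : Fin (j + 1) =>
            signVar x b ((Fin.snocEquiv fun _ : Fin (j + 1) => SignType) (0, ν) i) i)
          (fun i => b i) b₀ q (Finset.univ.filter fun i =>
            (Fin.snocEquiv fun _ : Fin (j + 1) => SignType) (0, ν) i ≠ 0) *
        (List.ofFn fun i : Fin (j + 1) =>
          signDiff σ ((Fin.snocEquiv fun _ : Fin (j + 1) => SignType) (0, ν) i) i).prod f =
        chainOp σ x b b₀ j q f := by
      rw [← ih]
      refine Finset.sum_congr rfl fun ν _ => ?_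
      rw [List.ofFn_succ']
      simp only [Fin.snocEquiv_apply, hinj ν 0, if_true, List.concat_eq_append, List.prod_append,
        List.prod_singleton, chainCoeff_map, Fin.snoc_last, Fin.snoc_castSucc,
        Module.End.mul_apply, Fin.val_last, he, Fin.val_castSucc]
      simp [signDiff]
    rw [SignType.univ_eq, Finset.sum_insert (by decide), Finset.sum_insert (by decide),
      Finset.sum_singleton, hzero, hrest _ (by decide), hrest _ (by decide), chainOp]
    simp only [signVar, signDiff, if_true, show (1 : SignType) ≠ -1 by decide,
      show (-1 : SignType) ≠ 1 by decide, if_false, LinearMap.sub_apply, Module.End.one_apply,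
      AlgEquiv.toLinearMap_apply]
    ring

end ChainSum

/-! ### Identification of `racahOp` with the recursive operator -/

section RatFun

variable {p : ℕ}

theorem ratFun_algHom_ext {φ ψ : RatFun p →ₐ[ℝ] RatFun p}
    (h : ∀ k, φ (toRat (MvPolynomial.X k)) = ψ (toRat (MvPolynomial.X k))) : φ = ψ := by
  have h1 : φ.comp (Algebra.algHom ℝ (MvPolynomial (Fin p) ℝ) (RatFun p)) =
      ψ.comp (Algebra.algHom ℝ (MvPolynomial (Fin p) ℝ) (RatFun p)) :=
    MvPolynomial.algHom_ext h
  have h2 : (φ : RatFun p →+* RatFun p) = (ψ : RatFun p →+* RatFun p) :=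
    IsLocalization.ringHom_ext (nonZeroDivisors (MvPolynomial (Fin p) ℝ))
      (RingHom.ext fun f => DFunLike.congr_fun h1 f)
  exact AlgHom.ext fun f => DFunLike.congr_fun h2 f

theorem toRat_C (c : ℝ) : (toRat (MvPolynomial.C c) : RatFun p) = algebraMap ℝ (RatFun p) c := by
  rw [toRat, ← MvPolynomial.algebraMap_eq, ← IsScalarTower.algebraMap_apply]

theorem shift_comm (i k : Fin p) : Commute (shift i) (shift k) := by
  have : ((shift i * shift k : RatFun p ≃ₐ[ℝ] RatFun p) : RatFun p →ₐ[ℝ] RatFun p) =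
      (shift k * shift i : RatFun p ≃ₐ[ℝ] RatFun p) := by
    apply ratFun_algHom_ext
    intro m
    simp only [AlgEquiv.coe_toAlgHom, AlgEquiv.mul_apply, shift_X, map_add]
    have h0 : ∀ (a c : Fin p), shift a (if m = c then (1 : RatFun p) else 0) =
        if m = c then 1 else 0 := fun a c => by split_ifs <;> simp
    rw [h0, h0]
    ring
  exact AlgEquiv.ext fun f => DFunLike.congr_fun this f

theorem forwardDiff_comm_backwardDiff (i k : Fin p) :
    Commute (forwardDiff i) (backwardDiff k) := by
  have h : Commute (shiftOp i) (shiftInvOp k) := by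
    refine LinearMap.ext fun f => ?_
    exact DFunLike.congr_fun ((shift_comm i k).inv_right) f
  exact (Commute.one_right _).sub_right (h.sub_left (Commute.one_left _))

end RatFun

/-- The operator groups all forward differences before all backward ones, whereas the recursion
works variable by variable; this lemma interleaves the two products. -/
theorem prod_ofFn_mul_prod_ofFn {R : Type*} [Monoid R] {n : ℕ} (A B : Fin n → R)
    (h : ∀ i k, Commute (A i) (B k)) :
    (List.ofFn A).prod * (List.ofFn B).prod = (List.ofFn fun i => A i * B i).prod := by
  induction n with
  | zero => simp
  | succ n ih =>
    rw [List.ofFn_succ, List.ofFn_succ, List.ofFn_succ, List.prod_cons, List.prod_cons,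
      List.prod_cons, ← ih _ _ fun i k => h _ _]
    have : Commute (List.ofFn fun i : Fin n => A i.succ).prod (B 0) := by
      apply Commute.list_prod_left
      intro a ha
      obtain ⟨i, rfl⟩ := List.mem_ofFn.mp ha
      exact h _ _
    rw [mul_assoc, mul_assoc, ← mul_assoc _ (B 0), this.eq, mul_assoc]

theorem prod_smul_prod_ofFn {R : Type*} [Ring R] [Algebra ℝ R] {n : ℕ} (c : Fin n → ℝ)
    (A : Fin n → R) : (∏ i, c i) • (List.ofFn A).prod = (List.ofFn fun i => c i • A i).prod := by
  induction n with
  | zero => simp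
  | succ n ih =>
    rw [List.ofFn_succ, List.ofFn_succ, List.prod_cons, List.prod_cons, ← ih,
      Fin.prod_univ_succ, smul_mul_smul_comm]

section Concrete

variable {p : ℕ}

/-- The variables of `RatFun p`, continued by the constant `N`. -/
noncomputable def seqVar (p : ℕ) (N : ℝ) (i : ℕ) : RatFun p :=
  if h : i < p then toRat (MvPolynomial.X ⟨i, h⟩) else toRat (MvPolynomial.C N)

/-- The shifts of `RatFun p`, continued by the identity. -/
noncomputable def seqShift (p : ℕ) (i : ℕ) : RatFun p ≃ₐ[ℝ] RatFun p :=
  if h : i < p then shift ⟨i, h⟩ else AlgEquiv.refl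

/-- The parameters `β₁, β₂, …`, continued by zero. -/
noncomputable def seqParam (β : Fin (p + 2) → ℝ) (i : ℕ) : RatFun p :=
  if h : i + 1 < p + 2 then toRat (MvPolynomial.C (β ⟨i + 1, h⟩)) else 0

theorem reflect_list_X {j : ℕ} (hj : j ≤ p) (b : Fin j → ℝ) (ν : Fin j → SignType) (i : Fin j)
    (l : List (Fin j)) (hl : l.Nodup) :
    (l.map fun k => if ν k = -1 then reflect (Fin.castLE hj k) (b k) else 1).prod
        (toRat (MvPolynomial.X (Fin.castLE hj i))) =
      if i ∈ l ∧ ν i = -1 then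
        -toRat (MvPolynomial.X (Fin.castLE hj i)) - toRat (MvPolynomial.C (b i))
      else toRat (MvPolynomial.X (Fin.castLE hj i)) := by
  induction l with
  | nil => simp
  | cons a l ih =>
    obtain ⟨ha, hl⟩ := List.nodup_cons.mp hl
    rw [List.map_cons, List.prod_cons, AlgEquiv.mul_apply, ih hl]
    have hC : ∀ c, reflect (Fin.castLE hj a) (b a) (toRat (MvPolynomial.C c)) =
        toRat (MvPolynomial.C c) := fun c => by rw [toRat_C, AlgEquiv.commutes]
    by_cases hai : i = a
    · subst hai
      by_cases hν : ν i = -1 <;> simp [ha, hν, reflect_X]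
    · have hX : reflect (Fin.castLE hj a) (b a) (toRat (MvPolynomial.X (Fin.castLE hj i))) =
          toRat (MvPolynomial.X (Fin.castLE hj i)) := by
        rw [reflect_X, if_neg (by simpa using hai)]
      by_cases hν : ν a = -1 <;> split_ifs <;> simp_all [List.mem_cons]

theorem prod_apply_eq_self (l : List (RatFun p ≃ₐ[ℝ] RatFun p)) (m : RatFun p)
    (h : ∀ g ∈ l, g m = m) : l.prod m = m := by
  induction l with
  | nil => simp
  | cons a l ih =>
    rw [List.prod_cons, AlgEquiv.mul_apply, ih fun g hg => h g (List.mem_cons_of_mem _ hg),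
      h a List.mem_cons_self]

/-- The composite of the reflections is a field automorphism, so it acts on the formula for $A_\nu$
by replacing each variable with its signed version; $M$ and the parameters are fixed. -/
theorem coeff_eq_chainCoeff {j : ℕ} (hj : j ≤ p) (β : Fin (j + 2) → ℝ) (M : RatFun p)
    (hM : ∀ (i : Fin j) (c : ℝ), reflect (Fin.castLE hj i) c M = M) (N : ℝ) (b : ℕ → RatFun p)
    (hb : ∀ i : Fin j, b i = varParam β i) (ν : Fin j → SignType) :
    coeff hj β M ν =
      chainCoeff (fun i : Fin j => signVar (seqVar p N) b (ν i) i) (fun i => b i) (param β 0)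
        (fun u => (u + param β (Fin.last (j + 1)) + M) * (M - u))
        (Finset.univ.filter fun i => ν i ≠ 0) := by
  rw [coeff]
  set ρ := (List.ofFn fun i : Fin j =>
      if ν i = -1 then reflect (Fin.castLE hj i) (β i.succ.castSucc) else 1).prod with hρ
  have hvar : ∀ i : Fin j, ρ (var hj i) = signVar (seqVar p N) b (ν i) i := by
    intro i
    rw [hρ, List.ofFn_eq_map, var, reflect_list_X hj (fun k => β k.succ.castSucc) ν i _
      (List.nodup_finRange j), signVar, hb, seqVar, dif_pos (i.isLt.trans_le hj)]
    by_cases hν : ν i = -1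
    · rw [if_pos ⟨List.mem_finRange i, hν⟩, if_pos hν]
      rfl
    · rw [if_neg fun h => hν h.2, if_neg hν]
      rfl
  have hpar : ∀ i, ρ (param β i) = param β i := fun i => by rw [param, toRat_C, AlgEquiv.commutes]
  have hvp : ∀ i, ρ (varParam β i) = b i := fun i => by rw [hb, varParam, hpar]
  have hρM : ρ M = M := by
    apply prod_apply_eq_self
    intro g hg
    obtain ⟨i, rfl⟩ := List.mem_ofFn.mp hg
    by_cases hν : ν i = -1
    · simp [hν, hM]
    · simp [hν]
  by_cases hS : (Finset.univ.filter fun i => ν i ≠ 0).Nonempty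
  · rw [coeffPos, dif_pos hS, chainCoeff, dif_pos hS, consecProd]
    simp only [map_mul, map_div₀, map_add, map_sub, map_prod, hvar, hpar, hvp, hρM, map_one,
      map_ofNat]
    congr 3
    refine Finset.prod_congr rfl fun c _ => ?_
    split_ifs with hc
    · simp only [map_mul, map_add, hvar, hvp, map_one]
    · rw [map_one]
  · rw [coeffPos, dif_neg hS, chainCoeff, dif_neg hS, map_zero]

theorem racahOp_apply {j : ℕ} (hj : j ≤ p) (β : Fin (j + 2) → ℝ) (M : RatFun p)
    (hM : ∀ (i : Fin j) (c : ℝ), reflect (Fin.castLE hj i) c M = M) (N : ℝ) (b : ℕ → RatFun p)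
    (hb : ∀ i : Fin j, b i = varParam β i) (f : RatFun p) :
    racahOp hj β M f =
      chainOp (seqShift p) (seqVar p N) b (param β 0) j
        (fun u => (u + param β (Fin.last (j + 1)) + M) * (M - u)) f := by
  rw [← sum_chainCoeff_eq_chainOp, racahOp, Finset.sum_filter, LinearMap.sum_apply]
  refine Finset.sum_congr rfl fun ν _ => ?_
  by_cases hν : ν = 0
  · subst hν
    simp [chainCoeff]
  · rw [if_pos hν, mul_assoc, prod_ofFn_mul_prod_ofFn, ← mul_smul_comm]
    · have hsign : (-1 : ℝ) ^ (Finset.univ.filter fun i => ν i = -1).card =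
          ∏ i : Fin j, if ν i = -1 then (-1 : ℝ) else 1 := by
        rw [Finset.prod_ite]; simp
      rw [hsign, prod_smul_prod_ofFn, Module.End.mul_apply, mulOp, LinearMap.mulLeft_apply,
        coeff_eq_chainCoeff hj β M hM N b hb]
      congr 4
      funext i
      have hs : seqShift p i = shift (Fin.castLE hj i) := dif_pos (i.isLt.trans_le hj)
      rw [signDiff, hs]
      rcases h : ν i with _ | _ | _
      · simp
      · simp [backwardDiff, shiftInvOp]
      · simp [forwardDiff, shiftOp]
    · intro i k
      split_ifs
      · exact forwardDiff_comm_backwardDiff _ _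
      all_goals simp

end Concrete

/-! ### The eigenvalue equation for the multivariable Racah polynomials -/

section Eigenfunctions

variable {p : ℕ} (β : Fin (p + 2) → ℝ) (N : ℝ)

theorem seqVar_fin (i : Fin p) : seqVar p N i = toRat (MvPolynomial.X i) := dif_pos i.isLt

theorem seqShift_fin (i : Fin p) : seqShift p i = shift i := dif_pos i.isLt

theorem shift_algebraMap (i : ℕ) (c : ℝ) :
    seqShift p i (algebraMap ℝ (RatFun p) c) = algebraMap ℝ (RatFun p) c := AlgEquiv.commutes _ _

theorem seqParam_eq_algebraMap (i : ℕ) : ∃ c : ℝ, seqParam β i = algebraMap ℝ (RatFun p) c := by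
  unfold seqParam
  split_ifs with h
  · exact ⟨_, toRat_C _⟩
  · exact ⟨0, (map_zero _).symm⟩

theorem isShiftSystem : IsShiftSystem p (seqShift p) (seqVar p N) (seqParam β)
    (toRat (MvPolynomial.C (β 0))) where
  shift_self i hi := by
    have := shift_X (⟨i, hi⟩ : Fin p) ⟨i, hi⟩
    rwa [if_pos rfl, ← seqVar_fin N, ← seqShift_fin] at this
  shift_of_ne i hi k hk := by
    by_cases hkp : k < p
    · have := shift_X (⟨i, hi⟩ : Fin p) ⟨k, hkp⟩
      rwa [if_neg (by simpa using hk), add_zero, ← seqVar_fin N, ← seqShift_fin] at this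
    · rw [seqVar, dif_neg hkp, toRat_C, shift_algebraMap]
  shift_const i _ k := by
    obtain ⟨c, hc⟩ := seqParam_eq_algebraMap β k
    rw [hc, shift_algebraMap]
  shift_const_zero i _ := by rw [toRat_C, shift_algebraMap]
  -- Shifting $x_i$ in the supposed equation and subtracting leaves $2=0$.
  ne_zero i hi m h := by
    have h2 := congrArg (seqShift p i) h
    obtain ⟨c, hc⟩ := seqParam_eq_algebraMap β i
    have hX := shift_X (⟨i, hi⟩ : Fin p) ⟨i, hi⟩
    rw [if_pos rfl, ← seqVar_fin N, ← seqShift_fin] at hX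
    rw [map_add, map_add, map_mul, map_ofNat, hX, hc, shift_algebraMap, map_intCast, map_zero,
      ← hc] at h2
    have : (2 : RatFun p) = 0 := by linear_combination h2 - h
    exact two_ne_zero this

theorem toRat_extVar (i : Fin (p + 1)) : toRat (extVar N i) = seqVar p N i := by
  induction i using Fin.lastCases with
  | last => simp [extVar, seqVar]
  | cast i => simp [extVar, seqVar]

theorem toRat_C_succ (i : ℕ) (h : i + 1 < p + 2) :
    toRat (MvPolynomial.C (β ⟨i + 1, h⟩)) = seqParam β i := by
  rw [seqParam, dif_pos h]

theorem reflect_seqVar (i : Fin p) (c : ℝ) (k : ℕ) (hk : (i : ℕ) ≠ k) :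
    reflect i c (seqVar p N k) = seqVar p N k := by
  unfold seqVar
  split_ifs with h
  · rw [reflect_X, if_neg]
    rintro rfl
    exact hk rfl
  · rw [toRat_C, AlgEquiv.commutes]

theorem racahOpAt_apply (j : Fin p) (f : RatFun p) :
    racahOpAt β N j f =
      chainOp (seqShift p) (seqVar p N) (seqParam β) (toRat (MvPolynomial.C (β 0))) (j + 1)
        (fun u => (u + seqParam β (j + 1) + seqVar p N (j + 1)) * (seqVar p N (j + 1) - u)) f := by
  rw [racahOpAt, toRat_extVar, racahOp_apply _ _ _ _ N (seqParam β)]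
  · have h1 : param (p := p) (fun i : Fin (j + 1 + 2) => β (Fin.castLE (by omega) i))
        (Fin.last (j + 1 + 1)) = seqParam β (j + 1) := toRat_C_succ β (j + 1) (by omega)
    rw [h1]
    rfl
  · intro i
    exact (toRat_C_succ β i (by omega)).symm
  · intro i c
    exact reflect_seqVar N _ c _ (by simpa using i.isLt.ne)

/-- A multi-index, continued by zero. -/
def seqIndex (n : Fin p → ℕ) (i : ℕ) : ℕ := if h : i < p then n ⟨i, h⟩ else 0

theorem sum_Iio_eq (n : Fin p → ℕ) (k : Fin p) :
    ∑ i ∈ Finset.Iio k, n i = ∑ i ∈ Finset.range k, seqIndex n i := by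
  have : Finset.range (k : ℕ) = (Finset.Iio k).map Fin.valEmbedding := by
    rw [Fin.map_valEmbedding_Iio]; ext; simp
  rw [this, Finset.sum_map]
  exact Finset.sum_congr rfl fun i _ => by simp [seqIndex]

theorem sum_Iic_eq (n : Fin p → ℕ) (k : Fin p) :
    ∑ i ∈ Finset.Iic k, n i = ∑ i ∈ Finset.range (k + 1), seqIndex n i := by
  have : Finset.range (k + 1 : ℕ) = (Finset.Iic k).map Fin.valEmbedding := by
    rw [Fin.map_valEmbedding_Iic]; ext; simp
  rw [this, Finset.sum_map]
  exact Finset.sum_congr rfl fun i _ => by simp [seqIndex]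

/-- The `l`-th factor of the multivariable Racah polynomial, `s` being the sum of the preceding
indices and `m` the current one. -/
noncomputable def seqFactor (l s m : ℕ) : RatFun p :=
  racahFactor m (toRat (MvPolynomial.C (β 0))) (seqParam β l) (seqParam β (l + 1)) (s : RatFun p)
    (seqVar p N l) (seqVar p N (l + 1))

theorem toRat_racahFactor (n : ℕ) (b₀ b b' s x M : MvPolynomial (Fin p) ℝ) :
    toRat (racahFactor n b₀ b b' s x M) =
      racahFactor n (toRat b₀) (toRat b) (toRat b') (toRat s) (toRat x) (toRat M) :=
  map_racahFactor (Algebra.algHom ℝ (MvPolynomial (Fin p) ℝ) (RatFun p)) n b₀ b b' s x M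

theorem racahPoly_eq_prod (n : Fin p → ℕ) :
    racahPoly β N n = ∏ k : Fin p, racahFactor (n k) (MvPolynomial.C (β 0))
      (MvPolynomial.C (β k.succ.castSucc)) (MvPolynomial.C (β k.succ.succ))
      ((∑ i ∈ Finset.Iio k, n i : ℕ) : MvPolynomial (Fin p) ℝ) (extVar N k.castSucc)
      (extVar N k.succ) := by
  simp only [racahPoly, racahFactor]

theorem toRat_racahPoly (n : Fin p → ℕ) :
    toRat (racahPoly β N n) =
      ∏ l ∈ Finset.range p,
        seqFactor β N l (∑ i ∈ Finset.range l, seqIndex n i) (seqIndex n l) := by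
  rw [racahPoly_eq_prod, toRat, map_prod, ← Fin.prod_univ_eq_prod_range
    (fun l => seqFactor β N l (∑ i ∈ Finset.range l, seqIndex n i) (seqIndex n l))]
  refine Finset.prod_congr rfl fun k _ => ?_
  have e3 : (toRat (MvPolynomial.C (β k.succ.castSucc)) : RatFun p) = seqParam β k :=
    toRat_C_succ β k (by omega)
  have e4 : (toRat (MvPolynomial.C (β k.succ.succ)) : RatFun p) = seqParam β (k + 1) :=
    toRat_C_succ β (k + 1) (by omega)
  have e5 : (toRat ((∑ i ∈ Finset.Iio k, n i : ℕ) : MvPolynomial (Fin p) ℝ) : RatFun p) =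
      ((∑ i ∈ Finset.range k, seqIndex n i : ℕ) : RatFun p) := by
    rw [toRat, map_natCast, sum_Iio_eq]
  refine (toRat_racahFactor _ _ _ _ _ _ _).trans ?_
  rw [e3, e4, e5, toRat_extVar, toRat_extVar, seqFactor,
    show seqIndex n k = n k by simp [seqIndex]]
  rfl

theorem racahPrefix_eq_prod (n : ℕ → ℕ) (k : ℕ) :
    racahPrefix (seqVar p N) (seqParam β) (toRat (MvPolynomial.C (β 0))) n k (seqVar p N k) =
      ∏ l ∈ Finset.range k, seqFactor β N l (∑ i ∈ Finset.range l, n i) (n l) := by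
  induction k with
  | zero => rfl
  | succ k ih => rw [racahPrefix, ih, Finset.prod_range_succ, seqFactor]

/-- The operator shifts only the variables with index at most $j$. Factors with index above $j$ do
not contain them and pull out, leaving the prefix of length $j+1$ with $M$ the next variable. -/
theorem racahOpAt_racahPoly (j : Fin p) (n : Fin p → ℕ) :
    racahOpAt β N j (toRat (racahPoly β N n)) =
      eigenvalue β j n • toRat (racahPoly β N n) := by
  have H := isShiftSystem (p := p) β N
  have hj : (j : ℕ) + 1 ≤ p := j.isLt
  rw [racahOpAt_apply, toRat_racahPoly, ← Finset.prod_range_mul_prod_Ico _ hj,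
    ← racahPrefix_eq_prod, mul_comm (racahPrefix _ _ _ _ _ _), chainOp_mul,
    (H.chainOp_racahPrefix (seqIndex n) hj (seqVar p N (j + 1)) _).1, Algebra.smul_def,
    eigenvalue, sum_Iic_eq, ← toRat_C_succ β (j + 1) (by omega), toRat_C, toRat_C]
  · simp only [map_neg, map_mul, map_sub, map_add, map_natCast, map_one]
    rw [show j.succ.succ = (⟨j + 1 + 1, by omega⟩ : Fin (p + 2)) from rfl]
    ring
  · intro i hi
    exact H.shift_of_ne i (by omega) _ (by omega)
  · intro i hi
    rw [map_prod]
    refine Finset.prod_congr rfl fun l hl => ?_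
    have hl' := (Finset.mem_Ico.mp hl).1
    have hip : i < p := by omega
    have := map_racahFactor (seqShift p i : RatFun p →ₐ[ℝ] RatFun p) (seqIndex n l)
      (toRat (MvPolynomial.C (β 0))) (seqParam β l) (seqParam β (l + 1))
      ((∑ i ∈ Finset.range l, seqIndex n i : ℕ) : RatFun p) (seqVar p N l) (seqVar p N (l + 1))
    rw [seqFactor]
    rw [AlgEquiv.coe_toAlgHom, H.shift_const_zero i hip, H.shift_const i hip, H.shift_const i hip,
      H.shift_of_ne i hip l (by omega), H.shift_of_ne i hip (l + 1) (by omega),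
      map_natCast] at this
    exact this

end Eigenfunctions

/-! ### Difference operators are determined on a small algebra -/

section Faithful

variable {p : ℕ}

/-- The translations of the variables by integers. -/
def translations (p : ℕ) : Submonoid (RatFun p ≃ₐ[ℝ] RatFun p) where
  carrier := {φ | ∀ k, ∃ m : ℤ, φ (toRat (MvPolynomial.X k)) = toRat (MvPolynomial.X k) + m}
  one_mem' k := ⟨0, by simp⟩
  mul_mem' := by
    intro φ ψ hφ hψ k
    obtain ⟨m, hm⟩ := hφ k
    obtain ⟨l, hl⟩ := hψ k
    refine ⟨m + l, ?_⟩
    rw [AlgEquiv.mul_apply, hl, map_add, hm, map_intCast]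
    push_cast
    ring

theorem shift_mem_translations (i : Fin p) : shift i ∈ translations p := by
  intro k
  rw [shift_X]
  by_cases hk : k = i
  · exact ⟨1, by simp [hk]⟩
  · exact ⟨0, by simp [hk]⟩

theorem shift_symm_mem_translations (i : Fin p) : (shift i).symm ∈ translations p := by
  intro k
  by_cases hk : k = i
  · refine ⟨-1, ?_⟩
    rw [AlgEquiv.symm_apply_eq, map_add, map_intCast, shift_X, if_pos hk]
    push_cast
    ring
  · refine ⟨0, ?_⟩
    rw [AlgEquiv.symm_apply_eq, map_add, map_intCast, shift_X, if_neg hk]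
    simp

/-- The difference operators, as the left `ℝ(x)`-span of the integer translations. -/
noncomputable def translationSpan (p : ℕ) : Submodule (RatFun p) (Op p) :=
  Submodule.span (RatFun p)
    (Set.range fun φ : translations p => (φ : RatFun p ≃ₐ[ℝ] RatFun p).toLinearMap)

theorem toLinearMap_mem_translationSpan {φ : RatFun p ≃ₐ[ℝ] RatFun p} (h : φ ∈ translations p) :
    (φ.toLinearMap : Op p) ∈ translationSpan p :=
  Submodule.subset_span ⟨⟨φ, h⟩, rfl⟩

theorem mul_mem_translationSpan {L L' : Op p} (hL : L ∈ translationSpan p)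
    (hL' : L' ∈ translationSpan p) : L * L' ∈ translationSpan p := by
  induction hL using Submodule.span_induction with
  | mem L hL =>
    obtain ⟨φ, rfl⟩ := hL
    induction hL' using Submodule.span_induction with
    | mem L' hL' =>
      obtain ⟨ψ, rfl⟩ := hL'
      exact toLinearMap_mem_translationSpan (φ * ψ).2
    | zero => rw [mul_zero]; exact zero_mem _
    | add x y _ _ hx hy => rw [mul_add]; exact add_mem hx hy
    | smul c x _ hx =>
      -- Moving a translation past a coefficient translates the coefficient.
      have : (φ : RatFun p ≃ₐ[ℝ] RatFun p).toLinearMap * (c • x) =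
          (φ : RatFun p ≃ₐ[ℝ] RatFun p) c •
            ((φ : RatFun p ≃ₐ[ℝ] RatFun p).toLinearMap * x) := by
        ext f; simp
      rw [this]
      exact Submodule.smul_mem _ _ hx
  | zero => rw [zero_mul]; exact zero_mem _
  | add x y _ _ hx hy => rw [add_mul]; exact add_mem hx hy
  | smul c x _ hx =>
    have : (c • x) * L' = c • (x * L') := rfl
    rw [this]
    exact Submodule.smul_mem _ _ hx

theorem diffAlgebra_le_translationSpan {L : Op p} (hL : L ∈ diffAlgebra p) :
    L ∈ translationSpan p := by
  have hone : (1 : Op p) ∈ translationSpan p :=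
    toLinearMap_mem_translationSpan (translations p).one_mem
  induction hL using Algebra.adjoin_induction with
  | mem L hL =>
    rcases hL with (⟨f, rfl⟩ | ⟨i, rfl⟩) | ⟨i, rfl⟩
    · have : mulOp f = f • (1 : Op p) := by
        ext g; simp [mulOp]
      rw [this]
      exact Submodule.smul_mem _ _ hone
    · exact toLinearMap_mem_translationSpan (shift_mem_translations i)
    · exact toLinearMap_mem_translationSpan (shift_symm_mem_translations i)
  | algebraMap r =>
    have : algebraMap ℝ (Op p) r = algebraMap ℝ (RatFun p) r • (1 : Op p) := by
      refine LinearMap.ext fun g => ?_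
      simp [Algebra.smul_def, Module.algebraMap_end_apply]
    rw [this]
    exact Submodule.smul_mem _ _ hone
  | add x y _ _ hx hy => exact add_mem hx hy
  | mul x y _ _ hx hy => exact mul_mem_translationSpan hx hy

/-- A difference operator is determined by its action on any algebra containing the quadratic
polynomials `x_k (x_k + b_k)`. -/
theorem eq_zero_of_forall_mem (β : Fin (p + 2) → ℝ) (N : ℝ) (A : Subalgebra ℝ (RatFun p))
    (hA : ∀ k < p, seqVar p N k * (seqVar p N k + seqParam β k) ∈ A) {L : Op p}
    (hL : L ∈ translationSpan p) (h : ∀ a ∈ A, L a = 0) : L = 0 := by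
  obtain ⟨c, rfl⟩ := Finsupp.mem_span_range_iff_exists_finsupp.mp hL
  let χ : translations p → (A →* RatFun p) := fun φ =>
    ((φ : RatFun p ≃ₐ[ℝ] RatFun p) : RatFun p →* RatFun p).comp (A.val : A →* RatFun p)
  -- If translations by $m$ and $l$ agree on $x(x+b)$, then $(m-l)(2x+b+m+l)=0$, and the second
  -- factor is nonzero. Distinct translations thus stay distinct characters on $A$, and Dedekind's
  -- independence applies.
  have hχ : Function.Injective χ := by
    rintro ⟨φ, hφ⟩ ⟨ψ, hψ⟩ e
    have key : (φ : RatFun p →ₐ[ℝ] RatFun p) = ψ := by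
      apply ratFun_algHom_ext
      intro k
      obtain ⟨m, hm⟩ := hφ k
      obtain ⟨l, hl⟩ := hψ k
      have e2 : φ (seqVar p N k * (seqVar p N k + seqParam β k)) =
          ψ (seqVar p N k * (seqVar p N k + seqParam β k)) :=
        DFunLike.congr_fun e ⟨_, hA k k.isLt⟩
      obtain ⟨b, hb⟩ := seqParam_eq_algebraMap β k
      have hne := (isShiftSystem β N).ne_zero k k.isLt (m + l)
      rw [seqVar_fin] at e2 hne
      rw [hb] at e2 hne
      simp only [map_mul, map_add, hm, hl, AlgEquiv.commutes] at e2
      push_cast at hne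
      have hml : (m : RatFun p) = l := by
        apply sub_eq_zero.mp
        apply (mul_eq_zero.mp _).resolve_right hne
        linear_combination e2
      change φ _ = ψ _
      rw [hm, hl, hml]
    exact Subtype.ext (AlgEquiv.ext fun f => DFunLike.congr_fun key f)
  have hli := (linearIndependent_monoidHom A (RatFun p)).comp χ hχ
  rw [linearIndependent_iff] at hli
  rw [hli c, Finsupp.sum_zero_index]
  funext a
  have := h a a.2
  rw [Finsupp.sum, LinearMap.sum_apply] at this
  rw [Finsupp.linearCombination_apply, Finsupp.sum, Finset.sum_apply]
  exact this

end Faithful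

/-! ### Membership in the difference algebra and dependence on $\beta_0$ -/

section Operators

variable {p : ℕ}

theorem mulOp_mem_diffAlgebra (f : RatFun p) : mulOp f ∈ diffAlgebra p :=
  Algebra.subset_adjoin (Or.inl (Or.inl ⟨f, rfl⟩))

theorem forwardDiff_mem_diffAlgebra (i : Fin p) : forwardDiff i ∈ diffAlgebra p :=
  sub_mem (Algebra.subset_adjoin (Or.inl (Or.inr ⟨i, rfl⟩))) (one_mem _)

theorem backwardDiff_mem_diffAlgebra (i : Fin p) : backwardDiff i ∈ diffAlgebra p :=
  sub_mem (one_mem _) (Algebra.subset_adjoin (Or.inr ⟨i, rfl⟩))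

theorem racahOp_mem_diffAlgebra {j : ℕ} (hj : j ≤ p) (β : Fin (j + 2) → ℝ) (M : RatFun p) :
    racahOp hj β M ∈ diffAlgebra p := by
  refine sum_mem fun ν _ => Subalgebra.smul_mem _ (mul_mem (mul_mem (mulOp_mem_diffAlgebra _)
    (list_prod_mem fun L hL => ?_)) (list_prod_mem fun L hL => ?_)) _
  · obtain ⟨i, rfl⟩ := List.mem_ofFn.mp hL
    split_ifs
    exacts [forwardDiff_mem_diffAlgebra _, one_mem _]
  · obtain ⟨i, rfl⟩ := List.mem_ofFn.mp hL
    split_ifs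
    exacts [backwardDiff_mem_diffAlgebra _, one_mem _]

theorem racahOpAt_mem_diffAlgebra (β : Fin (p + 2) → ℝ) (N : ℝ) (j : Fin p) :
    racahOpAt β N j ∈ diffAlgebra p := racahOp_mem_diffAlgebra _ _ _

/-- Each coefficient contains $b_0$ once, in the factor of the first active variable. The operator
is therefore the affine interpolation of its values at $b_0=0$ and $b_0=1$. -/
theorem chainOp_const_affine {K : Type*} [Field K] [Algebra ℝ K] (σ : ℕ → K ≃ₐ[ℝ] K)
    (x b : ℕ → K) (b₀ : K) (k : ℕ) (q : K → K) (f : K) :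
    chainOp σ x b b₀ k q f = chainOp σ x b 0 k q f +
      b₀ * (chainOp σ x b 1 k q f - chainOp σ x b 0 k q f) := by
  induction k generalizing q f with
  | zero => simp [chainOp]
  | succ k ih =>
    rw [chainOp, ih, ih _ (σ k f - f), ih _ ((σ k).symm f - f), chainOp, chainOp]
    ring

/-- The Racah operators depend affinely on `β₀`. -/
theorem racahOpAt_update (β : Fin (p + 2) → ℝ) (N : ℝ) (j : Fin p) (t : ℝ) :
    racahOpAt (Function.update β 0 t) N j = racahOpAt (Function.update β 0 0) N j +
      t • (racahOpAt (Function.update β 0 1) N j - racahOpAt (Function.update β 0 0) N j) := by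
  have hp : ∀ t, seqParam (Function.update β 0 t) = seqParam β := by
    intro t
    funext i
    unfold seqParam
    split_ifs with h
    · rw [Function.update_of_ne]
      exact fun h => by simpa using congrArg Fin.val h
    · rfl
  refine LinearMap.ext fun f => ?_
  simp only [LinearMap.add_apply, LinearMap.smul_apply, LinearMap.sub_apply, racahOpAt_apply, hp,
    Function.update_self]
  rw [chainOp_const_affine, toRat_C, toRat_C, toRat_C, Algebra.smul_def, map_zero, map_one]

end Operators

/-! ### Spanning by Racah polynomials for generic $\beta_0$ -/

theorem poch_mem {A S : Type*} [CommRing A] [SetLike S A] [SubringClass S A] (B : S) {u : A}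
    (hu : u ∈ B) (k : ℕ) : poch u k ∈ B := by
  induction k with
  | zero => rw [poch_zero]; exact one_mem B
  | succ k ih => rw [poch_succ]; exact mul_mem ih (add_mem hu (natCast_mem B k))

theorem poch_ne_zero {A : Type*} [CommRing A] [IsDomain A] {u : A} {k : ℕ}
    (h : ∀ i < k, u + (i : A) ≠ 0) : poch u k ≠ 0 := by
  induction k with
  | zero => simp
  | succ k ih =>
    rw [poch_succ]
    exact mul_ne_zero (ih fun i hi => h i (hi.trans k.lt_succ_self)) (h k k.lt_succ_self)

theorem pochBasis_succ' {A : Type*} [CommRing A] (b s x : A) (l : ℕ) :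
    pochBasis b s (l + 1) x =
      ((s + l) * (s + l + b) - x * (x + b)) * pochBasis b s l x := by
  rw [pochBasis_succ]; ring

theorem pochBasis_mem {A : Type*} [CommRing A] [Algebra ℝ A] (B : Subalgebra ℝ A) {b s x : A}
    (hb : b ∈ B) (hs : s ∈ B) (hx : x * (x + b) ∈ B) (l : ℕ) : pochBasis b s l x ∈ B := by
  induction l with
  | zero => rw [pochBasis_zero]; exact one_mem B
  | succ l ih =>
    rw [pochBasis_succ']
    have := natCast_mem B l
    exact mul_mem (sub_mem (mul_mem (add_mem hs this) (add_mem (add_mem hs this) hb)) hx) ih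

/-- The $M$-dependent part is itself a `pochBasis` element in $M$ with parameter $b'$, hence a
polynomial in $M(M+b')$. -/
theorem racahCoeff_mem {A : Type*} [CommRing A] [Algebra ℝ A] (B : Subalgebra ℝ A)
    {b₀ b b' s M : A} (hb₀ : b₀ ∈ B) (hb : b ∈ B) (hb' : b' ∈ B) (hs : s ∈ B)
    (hM : M * (M + b') ∈ B) (n l : ℕ) : racahCoeff n b₀ b b' s M l ∈ B := by
  have e : poch (s + b' + M + (l : A)) (n - l) * poch (s - M + l) (n - l) =
      pochBasis b' (s + l) (n - l) M := by
    rw [pochBasis, mul_comm]; congr 2 <;> ring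
  have h2 : (2 : A) * s ∈ B := mul_mem (ofNat_mem B 2) hs
  rw [racahCoeff, mul_assoc (poch (2 * s + b - b₀ + l) _), e]
  refine B.smul_mem (mul_mem (mul_mem (poch_mem B (neg_mem (natCast_mem B n)) l) (poch_mem B ?_ l))
    (mul_mem (poch_mem B ?_ _) ?_)) _
  · exact sub_mem (sub_mem (add_mem (add_mem (natCast_mem B n) h2) hb') hb₀) (one_mem B)
  · exact add_mem (sub_mem (add_mem h2 hb) hb₀) (natCast_mem B l)
  · exact pochBasis_mem B hb' (add_mem hs (natCast_mem B l)) hM _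

section Span

variable {p : ℕ} (β : Fin (p + 2) → ℝ) (N : ℝ)

/-- The algebra generated by the quadratic polynomials `x_l (x_l + b_l)`, `k ≤ l < p`. -/
noncomputable def quadAlgebra (k : ℕ) : Subalgebra ℝ (RatFun p) :=
  Algebra.adjoin ℝ ((fun l => seqVar p N l * (seqVar p N l + seqParam β l)) '' Set.Ico k p)

/-- The product of the factors with index at least `k` of a multivariable Racah polynomial, `s`
being the sum of the first `k` indices. -/
noncomputable def racahTail (k s : ℕ) (n : ℕ → ℕ) : RatFun p :=
  ∏ l ∈ Finset.Ico k p, seqFactor β N l (s + ∑ i ∈ Finset.Ico k l, n i) (n l)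

theorem seqParam_mem (A : Subalgebra ℝ (RatFun p)) (i : ℕ) : seqParam β i ∈ A := by
  obtain ⟨c, hc⟩ := seqParam_eq_algebraMap β i
  rw [hc]
  exact A.algebraMap_mem c

theorem toRat_C_mem (A : Subalgebra ℝ (RatFun p)) (c : ℝ) :
    (toRat (MvPolynomial.C c) : RatFun p) ∈ A := by
  rw [toRat_C]
  exact A.algebraMap_mem c

theorem quad_mem_quadAlgebra {k l : ℕ} (hkl : k ≤ l) :
    seqVar p N l * (seqVar p N l + seqParam β l) ∈ quadAlgebra β N k := by
  by_cases hl : l < p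
  · exact Algebra.subset_adjoin ⟨l, ⟨hkl, hl⟩, rfl⟩
  · rw [seqVar, dif_neg hl]
    exact mul_mem (toRat_C_mem _ N) (add_mem (toRat_C_mem _ N) (seqParam_mem β _ l))

theorem quadAlgebra_le_span {k : ℕ} (s : RatFun p)
    (hs : ∃ r : ℝ, s = algebraMap ℝ (RatFun p) r) {f : RatFun p} (hf : f ∈ quadAlgebra β N k) :
    f ∈ Submodule.span ℝ {u | ∃ m : ℕ, ∃ g ∈ quadAlgebra β N (k + 1),
      u = pochBasis (seqParam β k) s m (seqVar p N k) * g} := by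
  set U := Submodule.span ℝ {u | ∃ m : ℕ, ∃ g ∈ quadAlgebra β N (k + 1),
      u = pochBasis (seqParam β k) s m (seqVar p N k) * g} with hU
  have hsA : s ∈ quadAlgebra β N (k + 1) := by
    obtain ⟨r, rfl⟩ := hs
    exact Subalgebra.algebraMap_mem _ r
  have hgen : ∀ m : ℕ, ∀ g ∈ quadAlgebra β N (k + 1),
      pochBasis (seqParam β k) s m (seqVar p N k) * g ∈ U :=
    fun m g hg => Submodule.subset_span ⟨m, g, hg, rfl⟩
  -- The span is shown to be stable under multiplication by the algebra; applying this to $1\in U$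
  -- gives the claim. For the generator in $x_k$, stability is the recursion `pochBasis_succ'`.
  have hstab : ∀ u ∈ U, f * u ∈ U := by
    induction hf using Algebra.adjoin_induction with
    | mem a ha =>
      obtain ⟨l, ⟨hkl, hlp⟩, rfl⟩ := ha
      intro u hu
      induction hu using Submodule.span_induction with
      | mem u hu =>
        obtain ⟨m, g, hg, rfl⟩ := hu
        rcases hkl.eq_or_lt with rfl | hkl
        · have e : seqVar p N k * (seqVar p N k + seqParam β k) *
              (pochBasis (seqParam β k) s m (seqVar p N k) * g) =
              pochBasis (seqParam β k) s m (seqVar p N k) *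
                (((s + m) * (s + m + seqParam β k)) * g) -
              pochBasis (seqParam β k) s (m + 1) (seqVar p N k) * g := by
            rw [pochBasis_succ']; ring
          have hsm := add_mem hsA (natCast_mem (quadAlgebra β N (k + 1)) m)
          dsimp only
          rw [e]
          exact sub_mem (hgen m _ (mul_mem (mul_mem hsm (add_mem hsm (seqParam_mem β _ k))) hg))
            (hgen (m + 1) g hg)
        · dsimp only
          rw [mul_left_comm]
          exact hgen m _ (mul_mem (quad_mem_quadAlgebra β N hkl) hg)
      | zero => rw [mul_zero]; exact zero_mem _
      | add x y _ _ hx hy => rw [mul_add]; exact add_mem hx hy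
      | smul c x _ hx => rw [mul_smul_comm]; exact U.smul_mem c hx
    | algebraMap r =>
      intro u hu
      rw [← Algebra.smul_def]
      exact U.smul_mem r hu
    | add x y _ _ hx hy =>
      intro u hu
      rw [add_mul]
      exact add_mem (hx u hu) (hy u hu)
    | mul x y _ _ hx hy =>
      intro u hu
      rw [mul_assoc]
      exact hx _ (hy u hu)
  have h1 : (1 : RatFun p) ∈ U := by
    have := hgen 0 1 (one_mem _)
    rwa [pochBasis_zero, mul_one] at this
  simpa using hstab 1 h1

/-- The factor of degree $m$ raises the running sum to $s+m$, which is why the tail after it must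
start from that value. -/
theorem seqFactor_mul_mem {k : ℕ} (hk : k < p) (s m : ℕ) {g : RatFun p}
    (hg : g ∈ Submodule.span ℝ (Set.range (racahTail β N (k + 1) (s + m)))) :
    seqFactor β N k s m * g ∈ Submodule.span ℝ (Set.range (racahTail β N k s)) := by
  induction hg using Submodule.span_induction with
  | mem g hg =>
    obtain ⟨n, rfl⟩ := hg
    refine Submodule.subset_span ⟨Function.update n k m, ?_⟩
    rw [racahTail, Finset.prod_eq_prod_Ico_succ_bot hk, racahTail]
    congr 1
    · simp
    · refine Finset.prod_congr rfl fun l hl => ?_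
      have hl' := (Finset.mem_Ico.mp hl).1
      have e : ∑ i ∈ Finset.Ico (k + 1) l, Function.update n k m i =
          ∑ i ∈ Finset.Ico (k + 1) l, n i := by
        refine Finset.sum_congr rfl fun i hi => Function.update_of_ne ?_ _ _
        have := (Finset.mem_Ico.mp hi).1
        omega
      rw [Finset.sum_eq_sum_Ico_succ_bot (by omega : k < l), e, Function.update_self,
        Function.update_of_ne (by omega), add_assoc]
  | zero => rw [mul_zero]; exact zero_mem _
  | add x y _ _ hx hy => rw [mul_add]; exact add_mem hx hy
  | smul c x _ hx => rw [mul_smul_comm]; exact Submodule.smul_mem _ c hx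

/-- At $l=n$ only $(-n)_n\,(n+2s+b'-b_0-1)_n/n!$ survives, and genericity excludes a zero of the
second factor. -/
theorem racahCoeff_self_ne_zero {K : Type*} [Field K] [Algebra ℝ K] (b₀ b b' s M : K) (n : ℕ)
    (h : ∀ i : ℕ, (n : K) + 2 * s + b' - b₀ - 1 + i ≠ 0) : racahCoeff n b₀ b b' s M n ≠ 0 := by
  have : CharZero K := charZero_of_injective_algebraMap (algebraMap ℝ K).injective
  have hn : poch (-(n : K)) n ≠ 0 := by
    refine poch_ne_zero fun i hi => ?_
    rw [neg_add_eq_sub, sub_ne_zero]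
    exact_mod_cast hi.ne
  have hf : ((n.factorial : ℝ)⁻¹) ≠ 0 := by positivity
  rw [racahCoeff, Algebra.smul_def]
  simp only [Nat.sub_self, poch_zero, mul_one]
  exact mul_ne_zero ((map_ne_zero _).mpr hf) (mul_ne_zero hn (poch_ne_zero fun i _ => h i))

/-- If `β_{l+1} - β₀` is never an integer, the multivariable Racah polynomials span the algebra of
polynomials in the `x_l (x_l + b_l)`. -/
theorem quadAlgebra_le_span_racahTail
    (hβ : ∀ l : ℕ, l < p → ∀ z : ℤ,
      seqParam β (l + 1) - toRat (MvPolynomial.C (β 0)) + (z : RatFun p) ≠ 0)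
    {k : ℕ} (hk : k ≤ p) (s : ℕ) {f : RatFun p} (hf : f ∈ quadAlgebra β N k) :
    f ∈ Submodule.span ℝ (Set.range (racahTail β N k s)) := by
  induction hk using Nat.decreasingInduction generalizing s f with
  | self =>
    rw [quadAlgebra, Set.Ico_self, Set.image_empty, Algebra.adjoin_empty, Algebra.mem_bot] at hf
    obtain ⟨r, rfl⟩ := hf
    rw [Algebra.algebraMap_eq_smul_one]
    refine Submodule.smul_mem _ r (Submodule.subset_span ⟨0, ?_⟩)
    rw [racahTail, Finset.Ico_self, Finset.prod_empty]
  | of_succ k hk ih =>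
    have hbasis : ∀ m : ℕ, ∀ g ∈ quadAlgebra β N (k + 1),
        pochBasis (seqParam β k) (s : RatFun p) m (seqVar p N k) * g ∈
          Submodule.span ℝ (Set.range (racahTail β N k s)) := by
      intro m
      induction m using Nat.strong_induction_on with
      | _ m ihm =>
        intro g hg
        have hc : ∀ A : Subalgebra ℝ (RatFun p),
            seqVar p N (k + 1) * (seqVar p N (k + 1) + seqParam β (k + 1)) ∈ A → ∀ l,
            racahCoeff m (toRat (MvPolynomial.C (β 0))) (seqParam β k) (seqParam β (k + 1))
              (s : RatFun p) (seqVar p N (k + 1)) l ∈ A := fun A hA l =>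
          racahCoeff_mem A (toRat_C_mem A _) (seqParam_mem β A _) (seqParam_mem β A _)
            (natCast_mem A s) hA m l
        -- The top coefficient does not involve $M$, so it may be computed at $M=0$, where it lies
        -- in the constants.
        have htop : ∃ r : ℝ, racahCoeff m (toRat (MvPolynomial.C (β 0))) (seqParam β k)
            (seqParam β (k + 1)) (s : RatFun p) (seqVar p N (k + 1)) m =
              algebraMap ℝ (RatFun p) r := by
          have h0 := racahCoeff_mem (⊥ : Subalgebra ℝ (RatFun p)) (toRat_C_mem ⊥ (β 0))
            (seqParam_mem β ⊥ k) (seqParam_mem β ⊥ (k + 1)) (natCast_mem ⊥ s) (M := 0)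
            (by rw [zero_mul]; exact zero_mem _) m m
          obtain ⟨r, hr⟩ := Algebra.mem_bot.mp h0
          refine ⟨r, ?_⟩
          rw [hr]
          simp [racahCoeff]
        obtain ⟨r, hr⟩ := htop
        have hr0 : r ≠ 0 := by
          rintro rfl
          rw [map_zero] at hr
          refine racahCoeff_self_ne_zero _ _ _ _ _ m (fun i h => ?_) hr
          refine hβ k hk (m + 2 * s - 1 + i) ?_
          push_cast
          linear_combination h
        have hexp := racahFactor_eq_sum m (toRat (MvPolynomial.C (β 0))) (seqParam β k)
          (seqParam β (k + 1)) (s : RatFun p) (seqVar p N k) (seqVar p N (k + 1))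
        rw [Finset.sum_range_succ, hr, ← seqFactor] at hexp
        -- The triangular expansion of the Racah factor is solved for its top basis element. The
        -- lower coefficients are polynomials in the next quadratic variable and are absorbed into
        -- $g$, to which the induction on the degree applies.
        have e : pochBasis (seqParam β k) (s : RatFun p) m (seqVar p N k) * g =
            r⁻¹ • (seqFactor β N k s m * g - ∑ l ∈ Finset.range m,
              pochBasis (seqParam β k) (s : RatFun p) l (seqVar p N k) *
              (racahCoeff m (toRat (MvPolynomial.C (β 0))) (seqParam β k) (seqParam β (k + 1))
                (s : RatFun p) (seqVar p N (k + 1)) l * g)) := by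
          rw [eq_inv_smul_iff₀ hr0, Algebra.smul_def, hexp, add_mul, Finset.sum_mul]
          simp only [mul_assoc, mul_left_comm (pochBasis _ _ _ _)]
          ring
        rw [e]
        refine Submodule.smul_mem _ _ (sub_mem (seqFactor_mul_mem β N hk s m (ih (s + m) hg))
          (sum_mem fun l hl => ihm l (Finset.mem_range.mp hl) _ (mul_mem
            (hc _ (quad_mem_quadAlgebra β N le_rfl) l) hg)))
    have hspan := quadAlgebra_le_span β N (s : RatFun p) ⟨s, by simp⟩ hf
    refine Submodule.span_le.mpr ?_ hspan
    rintro u ⟨m, g, hg, rfl⟩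
    exact hbasis m g hg

theorem racahTail_zero (n : ℕ → ℕ) :
    racahTail β N 0 0 n = toRat (racahPoly β N fun i : Fin p => n i) := by
  rw [toRat_racahPoly, racahTail, Finset.range_eq_Ico]
  have hn : ∀ i < p, seqIndex (fun i : Fin p => n i) i = n i := fun i hi => dif_pos hi
  refine Finset.prod_congr rfl fun l hl => ?_
  have hl' := (Finset.mem_Ico.mp hl).2
  rw [hn l hl', zero_add, Finset.range_eq_Ico]
  congr 1
  exact Finset.sum_congr rfl fun i hi => (hn i ((Finset.mem_Ico.mp hi).2.trans hl')).symm

end Span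

/-! ### Commutativity and diagonal action of the Racah algebra -/

section Commutation

variable {p : ℕ}

/-- The commutator annihilates every common eigenfunction, hence their span, which contains the
algebra on which difference operators are determined. -/
theorem commute_racahOpAt_of_generic (β : Fin (p + 2) → ℝ) (N : ℝ)
    (hβ : ∀ l : ℕ, l < p → ∀ z : ℤ,
      seqParam β (l + 1) - toRat (MvPolynomial.C (β 0)) + (z : RatFun p) ≠ 0) (i j : Fin p) :
    Commute (racahOpAt β N i) (racahOpAt β N j) := by
  rw [Commute, SemiconjBy, ← sub_eq_zero]
  have hmem := fun i => diffAlgebra_le_translationSpan (racahOpAt_mem_diffAlgebra β N i)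
  refine eq_zero_of_forall_mem β N (quadAlgebra β N 0)
    (fun k _ => quad_mem_quadAlgebra β N k.zero_le)
    (sub_mem (mul_mem_translationSpan (hmem i) (hmem j))
      (mul_mem_translationSpan (hmem j) (hmem i))) fun a ha => ?_
  have ha' := quadAlgebra_le_span_racahTail β N hβ p.zero_le 0 ha
  clear ha
  induction ha' using Submodule.span_induction with
  | mem f hf =>
    obtain ⟨n, rfl⟩ := hf
    rw [racahTail_zero, LinearMap.sub_apply, Module.End.mul_apply, Module.End.mul_apply,
      racahOpAt_racahPoly, racahOpAt_racahPoly, map_smul, map_smul, racahOpAt_racahPoly,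
      racahOpAt_racahPoly, smul_comm, sub_self]
  | zero => exact map_zero _
  | add x y _ _ hx hy => rw [map_add, hx, hy, add_zero]
  | smul c x _ hx => rw [map_smul, hx, smul_zero]

/-- The excluded values lie in the countable union of the cosets $\beta_i+\mathbb Z$. -/
theorem infinite_generic (β : Fin (p + 2) → ℝ) :
    {t : ℝ | ∀ l : ℕ, l < p → ∀ z : ℤ, seqParam (Function.update β 0 t) (l + 1) -
      toRat (MvPolynomial.C t) + (z : RatFun p) ≠ 0}.Infinite := by
  intro hfin
  refine Set.not_countable_univ (α := ℝ) (Set.Countable.mono ?_ (hfin.countable.union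
    (Set.countable_iUnion fun i : Fin (p + 2) => Set.countable_range fun z : ℤ => β i + z)))
  intro t _
  refine or_iff_not_imp_left.mpr fun ht => ?_
  simp only [Set.mem_ofPred_eq, not_forall, not_not] at ht
  obtain ⟨l, hl, z, h⟩ := ht
  refine Set.mem_iUnion.mpr ⟨⟨l + 1 + 1, by omega⟩, z, ?_⟩
  have hne : (⟨l + 1 + 1, by omega⟩ : Fin (p + 2)) ≠ 0 := by simp [Fin.ext_iff]
  rw [← toRat_C_succ _ (l + 1) (by omega), Function.update_of_ne hne, toRat_C, toRat_C,
    ← map_intCast (algebraMap ℝ (RatFun p)), ← map_sub, ← map_add, map_eq_zero] at h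
  dsimp only
  linear_combination h

theorem commute_racahOpAt (β : Fin (p + 2) → ℝ) (N : ℝ) (i j : Fin p) :
    Commute (racahOpAt β N i) (racahOpAt β N j) := by
  set U := fun i => racahOpAt (Function.update β 0 0) N i with hU
  set V := fun i => racahOpAt (Function.update β 0 1) N i - U i with hV
  have hupd : ∀ t i, racahOpAt (Function.update β 0 t) N i = U i + t • V i :=
    fun t i => racahOpAt_update β N i t
  have hexp : ∀ t : ℝ, (U i + t • V i) * (U j + t • V j) - (U j + t • V j) * (U i + t • V i) =
      (U i * U j - U j * U i) + t • (U i * V j + V i * U j - U j * V i - V j * U i) +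
        (t * t) • (V i * V j - V j * V i) := by
    intro t
    simp only [mul_add, add_mul, smul_mul_assoc, mul_smul_comm, smul_sub, smul_add, smul_smul]
    abel
  rw [Commute, SemiconjBy, ← sub_eq_zero, ← Function.update_eq_self 0 β, hupd, hupd, hexp]
  refine LinearMap.ext fun f => ?_
  -- The commutator applied to a fixed $f$ is a polynomial in $\beta_0$ of degree at most two with
  -- coefficients in the field of rational functions. Its infinitely many generic real roots force
  -- it to vanish.
  let P : Polynomial (RatFun p) :=
    Polynomial.C ((U i * U j - U j * U i) f) +
      Polynomial.X * Polynomial.C ((U i * V j + V i * U j - U j * V i - V j * U i) f) +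
      Polynomial.X * Polynomial.X * Polynomial.C ((V i * V j - V j * V i) f)
  have hP : ∀ t : ℝ, P.eval (algebraMap ℝ (RatFun p) t) =
      ((U i * U j - U j * U i) + t • (U i * V j + V i * U j - U j * V i - V j * U i) +
        (t * t) • (V i * V j - V j * V i)) f := by
    intro t
    simp only [P, Polynomial.eval_add, Polynomial.eval_mul, Polynomial.eval_C, Polynomial.eval_X,
      LinearMap.add_apply, LinearMap.smul_apply]
    simp only [Algebra.smul_def, map_mul]
  have hroot : P = 0 := by
    refine Polynomial.eq_zero_of_infinite_isRoot P (((infinite_generic β).image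
      (algebraMap ℝ (RatFun p)).injective.injOn).mono ?_)
    rintro _ ⟨t, ht, rfl⟩
    have hc := commute_racahOpAt_of_generic (Function.update β 0 t) N
      (by rwa [Function.update_self]) i j
    rw [Commute, SemiconjBy, ← sub_eq_zero, hupd, hupd, hexp] at hc
    change P.eval _ = 0
    rw [hP, hc, LinearMap.zero_apply]
  rw [← hP, hroot, Polynomial.eval_zero, LinearMap.zero_apply]

theorem racahAlgebra_commute (β : Fin (p + 2) → ℝ) (N : ℝ) {L L' : Op p}
    (hL : L ∈ racahAlgebra β N) (hL' : L' ∈ racahAlgebra β N) : L * L' = L' * L := by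
  have h1 : ∀ i, ∀ M ∈ racahAlgebra β N, Commute M (racahOpAt β N i) := by
    intro i M hM
    induction hM using Algebra.adjoin_induction with
    | mem M hM =>
      obtain ⟨k, rfl⟩ := hM
      exact commute_racahOpAt β N k i
    | algebraMap r => exact Algebra.commute_algebraMap_left r _
    | add x y _ _ hx hy => exact hx.add_left hy
    | mul x y _ _ hx hy => exact hx.mul_left hy
  change Commute L L'
  induction hL' using Algebra.adjoin_induction with
  | mem M hM =>
    obtain ⟨k, rfl⟩ := hM
    exact h1 k L hL
  | algebraMap r => exact Algebra.commute_algebraMap_right r _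
  | add x y _ _ hx hy => exact hx.add_right hy
  | mul x y _ _ hx hy => exact hx.mul_right hy

theorem racahAlgebra_diagonal (β : Fin (p + 2) → ℝ) (N : ℝ) {L : Op p}
    (hL : L ∈ racahAlgebra β N) (n : Fin p → ℕ) :
    ∃ c : ℝ, L (toRat (racahPoly β N n)) = c • toRat (racahPoly β N n) := by
  induction hL using Algebra.adjoin_induction with
  | mem L hL =>
    obtain ⟨k, rfl⟩ := hL
    exact ⟨_, racahOpAt_racahPoly β N k n⟩
  | algebraMap r => exact ⟨r, Module.algebraMap_end_apply ..⟩
  | add x y _ _ hx hy =>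
    obtain ⟨c, hc⟩ := hx
    obtain ⟨d, hd⟩ := hy
    exact ⟨c + d, by rw [LinearMap.add_apply, hc, hd, add_smul]⟩
  | mul x y _ _ hx hy =>
    obtain ⟨c, hc⟩ := hx
    obtain ⟨d, hd⟩ := hy
    exact ⟨d * c, by rw [Module.End.mul_apply, hd, map_smul, hc, smul_smul]⟩

end Commutation

end Racah

theorem theorem3p9 (p : ℕ) (β : Fin (p + 2) → ℝ) (N : ℝ) :
    (∀ (j : Fin p) (n : Fin p → ℕ),
      Racah.racahOpAt β N j (Racah.toRat (Racah.racahPoly β N n)) =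
        Racah.eigenvalue β j n • Racah.toRat (Racah.racahPoly β N n)) ∧
    (∀ i j : Fin p, Commute (Racah.racahOpAt β N i) (Racah.racahOpAt β N j)) ∧
    Racah.racahAlgebra β N ≤ Racah.diffAlgebra p ∧
    (∀ L ∈ Racah.racahAlgebra β N, ∀ L' ∈ Racah.racahAlgebra β N, L * L' = L' * L) ∧
    (∀ L ∈ Racah.racahAlgebra β N, ∀ n : Fin p → ℕ, ∃ c : ℝ,
      L (Racah.toRat (Racah.racahPoly β N n)) = c • Racah.toRat (Racah.racahPoly β N n)) :=
  ⟨Racah.racahOpAt_racahPoly β N, Racah.commute_racahOpAt β N,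
    Algebra.adjoin_le (by rintro _ ⟨j, rfl⟩; exact Racah.racahOpAt_mem_diffAlgebra β N j),
    fun _ hL _ hL' => Racah.racahAlgebra_commute β N hL hL',
    fun _ hL n => Racah.racahAlgebra_diagonal β N hL n⟩
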